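/- Let $\Gamma$ be a countable set. Let $\mathbf{Hilb}_{\rm fin}$ be the category of non-zero finite-dimensional complex Hilbert spaces and linear isometries (not necessarily surjective); it is monoidal under the tensor product of Hilbert spaces and topologically enriched by giving each set of isometries $\mathcal H\to\mathcal K$ the subspace topology from the bounded linear maps. Let $\mathbf{cgTop}$ be the category of compactly generated spaces (weak Hausdorff $k$-spaces) and continuous maps; it is monoidal under the cartesian product ($k$-ification of the product topology) and topologically enriched by the $k$-ification of the compact-open topology. (A topological enrichment of a category is a choice of compactly generated topologies on the morphism sets such that composition is continuous; a functor is topologically enriched if it is continuous on morphism spaces.) For $\mathcal H\in\mathbf{Hilb}_{\rm fin}$ and finite $\Lambda\subseteq\Gamma$ let $\mathfrak A_\Lambda(\mathcal H)=\mathfrak B(\bigotimes_{v\in\Lambda}\mathcal H)\cong\bigotimes_{v\in\Lambda}\mathfrak B(\mathcal H)$. Let $\mathfrak A_\Gamma(\mathcal H)$ (the quasi-local algebra) be the C*-algebraic colimit, i.e. the completion of the union, of the algebras $\mathfrak A_\Lambda(\mathcal H)$ along the inclusions $\mathfrak A_{\Lambda}(\mathcal H)\hookrightarrow\mathfrak A_{\Lambda'}(\mathcal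 H)$, $\Lambda\subseteq\Lambda'$, which tensor with $1$ on $\Lambda'\setminus\Lambda$; let $\iota_\Lambda^{\mathcal H}\colon\mathfrak A_\Lambda(\mathcal H)\to\mathfrak A_\Gamma(\mathcal H)$ be the canonical inclusions. Let $\mathscr P_\Gamma(\mathcal H)$ be the set of pure states of $\mathfrak A_\Gamma(\mathcal H)$ (the extreme points of the set of positive normalized functionals) with the weak* topology. For an isometry $f\colon\mathcal H\to\mathcal K$ put $f_\Lambda=\bigotimes_{v\in\Lambda}f$, and let $\mathfrak A_\Gamma(f)\colon\mathfrak A_\Gamma(\mathcal K)\to\mathfrak A_\Gamma(\mathcal H)$ be the unique bounded linear map with $\mathfrak A_\Gamma(f)(\iota^{\mathcal K}_\Lambda(A))=\iota^{\mathcal H}_\Lambda(f_\Lambda^*Af_\Lambda)$ for all finite $\Lambda\subseteq\Gamma$ and all $A\in\mathfrak A_\Lambda(\mathcal K)$. For $A_1\in\mathfrak A_\Gamma(\mathcal H_1)$ and $A_2\in\mathfrak A_\Gamma(\mathcal H_2)$ let $A_1\otimes A_2\in\mathfrak A_\Gamma(\mathcal H_1\otimes\mathcal H_2)$ be determined by continuity,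 bilinearity and $(\bigotimes_{v}a_v)\otimes(\bigotimes_{v}b_v)=\bigotimes_{v}(a_v\otimes b_v)$ for $a_v\in\mathfrak B(\mathcal H_1)$, $b_v\in\mathfrak B(\mathcal H_2)$, $v$ in a finite set $\Lambda$. Then the spaces $\mathscr P_\Gamma(\mathcal H)$ are compactly generated, and there is a covariant functor $$\mathscr P_\Gamma\colon\mathbf{Hilb}_{\rm fin}\to\mathbf{cgTop}$$ which is $\mathcal H\mapsto\mathscr P_\Gamma(\mathcal H)$ on objects and sends $f\colon\mathcal H\to\mathcal K$ to the map $\mathscr P_\Gamma(f)\colon\mathscr P_\Gamma(\mathcal H)\to\mathscr P_\Gamma(\mathcal K)$, $\omega\mapsto\omega\circ\mathfrak A_\Gamma(f)$. The functor is topologically enriched, and each $\mathscr P_\Gamma(f)$ is a closed embedding. Furthermore, $\mathscr P_\Gamma$ is a lax monoidal functor whose structure maps, natural in $\mathcal H_1$ and $\mathcal H_2$, $$\mathscr P_\Gamma(\mathcal H_1)\times\mathscr P_\Gamma(\mathcal H_2)\to\mathscr P_\Gamma(\mathcal H_1\otimes\mathcal H_2)$$ send $(\omega_1,\omega_2)$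 to the tensor product state $\omega_1\otimes\omega_2$, i.e. the state with $(\omega_1\otimes\omega_2)(A_1\otimes A_2)=\omega_1(A_1)\,\omega_2(A_2)$ for all $A_1\in\mathfrak A_\Gamma(\mathcal H_1)$, $A_2\in\mathfrak A_\Gamma(\mathcal H_2)$. -/

import Mathlib

open CategoryTheory MonoidalCategory TopologicalSpace Topology
open scoped TensorProduct ComplexOrder

universe u v w

set_option linter.unusedSectionVars false

noncomputable section

namespace QST

/-! ### Compactly generated spaces (weak Hausdorff `k`-spaces) -/

/-- A space is weak Hausdorff if every continuous image of a compact Hausdorff space is closed. -/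
class WeakHausdorffSpace (X : Type u) [TopologicalSpace X] : Prop where
  isClosed_range : ∀ (K : Type u) [TopologicalSpace K] [CompactSpace K] [T2Space K] (f : K → X),
    Continuous f → IsClosed (Set.range f)

/-- Compactly generated spaces in the convention of algebraic topology:
weak Hausdorff `k`-spaces. -/
class CGWHSpace (X : Type u) [TopologicalSpace X] : Prop extends
  CompactlyGeneratedSpace X, WeakHausdorffSpace X

/-- The `k`-ification of a topology: a subset is closed iff its preimage under
every continuous map from a compact Hausdorff space is closed. -/
abbrev kTop (X : Type u) [TopologicalSpace X] : TopologicalSpace X :=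
  TopologicalSpace.compactlyGenerated.{u} X

section kTop

variable {X : Type u} [tX : TopologicalSpace X]

theorem continuous_kTop_of_compact {K : Type u} [tK : TopologicalSpace K] [CompactSpace K]
    [T2Space K] {g : K → X} (hg : Continuous g) : Continuous[tK, kTop X] g := by
  have h : Continuous (fun s : K =>
      (⟨⟨CompHaus.of K, ⟨g, hg⟩⟩, s⟩ : Σ i : (S : CompHaus.{u}) × C(S, X), i.1)) :=
    continuous_sigmaMk (σ := fun i : (S : CompHaus.{u}) × C(S, X) => i.1)
      (i := ⟨CompHaus.of K, ⟨g, hg⟩⟩)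
  have h2 : Continuous[inferInstance, kTop X]
    (fun z : (Σ i : (S : CompHaus.{u}) × C(S, X), i.1) => z.1.2 z.2) := continuous_coinduced_rng
  have h3 := @Continuous.comp _ _ _ _ _ (kTop X) _ _ h2 h
  exact h3

theorem continuous_kTop_id : Continuous[kTop X, tX] id :=
  continuous_from_compactlyGenerated.{u} _ fun _ g => g.continuous

theorem continuous_kTop {Y : Type u} [tY : TopologicalSpace Y] [CompactlyGeneratedSpace Y]
    {g : Y → X} (hg : Continuous g) : Continuous[tY, kTop X] g :=
  @continuous_from_compactlyGeneratedSpace Y X tY (kTop X) _ g fun _ _ _ _ _ hk =>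
    continuous_kTop_of_compact (hg.comp hk)

theorem compactlyGeneratedSpace_kTop : @CompactlyGeneratedSpace X (kTop X) :=
  @compactlyGeneratedSpace_of_continuous_maps X (kTop X) fun {Y} tY f h =>
    @continuous_from_compactlyGenerated.{u} X Y tX tY f fun S g =>
      h S (fun s => g s) (continuous_kTop_of_compact g.continuous)

theorem continuous_kTop_fst {Y : Type u} [TopologicalSpace Y] :
    Continuous[kTop (X × Y), tX] Prod.fst :=
  continuous_from_compactlyGenerated.{u} _ fun _ g => continuous_fst.comp g.continuous

theorem continuous_kTop_snd {Y : Type u} [tY : TopologicalSpace Y] :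
    Continuous[kTop (X × Y), tY] Prod.snd :=
  continuous_from_compactlyGenerated.{u} _ fun _ g => continuous_snd.comp g.continuous

end kTop

/-- In a weak Hausdorff space, coincidence sets of maps from compact Hausdorff spaces are
closed. -/
theorem WeakHausdorffSpace.isClosed_coincidence {X : Type u} [TopologicalSpace X]
    [WeakHausdorffSpace X] {S T : Type u} [TopologicalSpace S] [CompactSpace S] [T2Space S]
    [TopologicalSpace T] [CompactSpace T] [T2Space T] {f : S → X} {g : T → X}
    (hf : Continuous f) (hg : Continuous g) : IsClosed {p : S × T | f p.1 = g p.2} := by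
  have key : ∀ (K : Type u) [TopologicalSpace K] [CompactSpace K] [T2Space K] (h : K → X),
      Continuous h → ∀ C : Set K, IsClosed C → IsClosed (h '' C) := by
    intro K _ _ _ h hh C hC
    have : CompactSpace C := isCompact_iff_compactSpace.1 hC.isCompact
    have := WeakHausdorffSpace.isClosed_range C (fun c => h c) (hh.comp continuous_subtype_val)
    rwa [Set.range_comp' h, Subtype.range_coe] at this
  have hs : ∀ x : X, IsClosed ({x} : Set X) := by
    intro x
    simpa using WeakHausdorffSpace.isClosed_range PUnit (fun _ => x) continuous_const
  let h : S ⊕ T → X := Sum.elim f g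
  have hh : Continuous h := hf.sumElim hg
  rw [← isOpen_compl_iff, isOpen_prod_iff]
  intro a b hab
  have hd : Disjoint (h ⁻¹' {f a}) (h ⁻¹' {g b}) := by
    rw [Set.disjoint_left]
    rintro k hk hk'
    exact hab ((Set.mem_singleton_iff.1 hk).symm.trans (Set.mem_singleton_iff.1 hk'))
  obtain ⟨U, V, hU, hV, hAU, hBV, hUV⟩ :=
    normal_separation ((hs (f a)).preimage hh) ((hs (g b)).preimage hh) hd
  refine ⟨f ⁻¹' (h '' Uᶜ)ᶜ, g ⁻¹' (h '' Vᶜ)ᶜ,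
    ((key _ h hh _ hU.isClosed_compl).isOpen_compl).preimage hf,
    ((key _ h hh _ hV.isClosed_compl).isOpen_compl).preimage hg, ?_, ?_, ?_⟩
  · rintro ⟨k, hk, hk'⟩
    exact hk (hAU hk')
  · rintro ⟨k, hk, hk'⟩
    exact hk (hBV hk')
  · rintro ⟨s, t⟩ ⟨hs', ht'⟩ (hst : f s = g t)
    have h1 : Sum.inl s ∈ U := by
      by_contra hcon
      exact hs' ⟨Sum.inl s, hcon, rfl⟩
    have h2 : Sum.inl s ∈ V := by
      by_contra hcon
      exact ht' ⟨Sum.inl s, hcon, hst⟩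
    exact Set.disjoint_left.1 hUV h1 h2

/-- A `k`-space is weak Hausdorff if coincidence sets of maps from compact Hausdorff spaces
are closed. -/
theorem CGWHSpace.of_coincidence {X : Type u} [TopologicalSpace X] [CompactlyGeneratedSpace X]
    (h : ∀ (S K : Type u) [TopologicalSpace S] [CompactSpace S] [T2Space S] [TopologicalSpace K]
      [CompactSpace K] [T2Space K] (g : S → X) (f : K → X), Continuous g → Continuous f →
      IsClosed {q : S × K | g q.1 = f q.2}) : CGWHSpace X where
  isClosed_range K _ _ _ f hf := by
    refine CompactlyGeneratedSpace.isClosed' fun S _ _ _ g hg => ?_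
    have h2 : g ⁻¹' Set.range f = Prod.fst '' {q : S × K | g q.1 = f q.2} := by
      ext s
      constructor
      · rintro ⟨k, hk⟩
        exact ⟨(s, k), hk.symm, rfl⟩
      · rintro ⟨⟨s', k⟩, hq, rfl⟩
        exact ⟨k, hq.symm⟩
    rw [h2]
    exact ((h S K g f hg hf).isCompact.image continuous_fst).isClosed

instance (priority := 100) (X : Type u) [TopologicalSpace X] [T2Space X] :
    WeakHausdorffSpace X where
  isClosed_range _ _ _ _ _ hf := (isCompact_range hf).isClosed

/-- The category of compactly generated spaces and continuous maps. -/
structure CGTop : Type (u + 1) where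
  of ::
  /-- The underlying set. -/
  carrier : Type u
  [topology : TopologicalSpace carrier]
  [cgwh : CGWHSpace carrier]

namespace CGTop

instance : CoeSort CGTop.{u} (Type u) := ⟨carrier⟩

attribute [instance] topology cgwh

/-- Morphisms of compactly generated spaces are continuous maps. -/
@[ext] structure Hom (X Y : CGTop.{u}) where
  /-- The underlying continuous map. -/
  hom : C(X, Y)

instance : Category CGTop.{u} where
  Hom := Hom
  id X := ⟨ContinuousMap.id X⟩
  comp f g := ⟨g.hom.comp f.hom⟩

instance : ConcreteCategory CGTop.{u} (fun X Y => C(X, Y)) where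
  hom := Hom.hom
  ofHom := Hom.mk

theorem cgwhSpace_prod (X Y : Type u) [TopologicalSpace X] [TopologicalSpace Y]
    [WeakHausdorffSpace X] [WeakHausdorffSpace Y] : @CGWHSpace (X × Y) (kTop (X × Y)) := by
  refine @CGWHSpace.of_coincidence (X × Y) (kTop (X × Y)) compactlyGeneratedSpace_kTop ?_
  intro S K _ _ _ _ _ _ g f hg hf
  have h1 := WeakHausdorffSpace.isClosed_coincidence
    (@Continuous.comp _ _ _ _ (kTop (X × Y)) _ _ _ continuous_kTop_fst hg)
    (@Continuous.comp _ _ _ _ (kTop (X × Y)) _ _ _ continuous_kTop_fst hf)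
  have h2 := WeakHausdorffSpace.isClosed_coincidence
    (@Continuous.comp _ _ _ _ (kTop (X × Y)) _ _ _ continuous_kTop_snd hg)
    (@Continuous.comp _ _ _ _ (kTop (X × Y)) _ _ _ continuous_kTop_snd hf)
  convert h1.inter h2 using 1
  ext q
  exact Prod.ext_iff

/-- The product of compactly generated spaces: the `k`-ification of the product space. -/
def prod (X Y : CGTop.{u}) : CGTop.{u} :=
  @CGTop.of (X × Y) (kTop (X × Y)) (cgwhSpace_prod X Y)

/-- The one-point space. -/
def pt : CGTop.{u} :=
  @CGTop.of PUnit _ { }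

/-- A continuous map into the `k`-product from a compactly generated space. -/
def lift {X Y Z : CGTop.{u}} (f : C(Z, X)) (g : C(Z, Y)) : Z ⟶ prod X Y :=
  ⟨@ContinuousMap.mk Z (X × Y) _ (kTop (X × Y)) (fun z => (f z, g z))
    (continuous_kTop (f.continuous.prodMk g.continuous))⟩

/-- First projection. -/
def fst (X Y : CGTop.{u}) : C(prod X Y, X) :=
  @ContinuousMap.mk (X × Y) X (kTop (X × Y)) _ Prod.fst continuous_kTop_fst

/-- Second projection. -/
def snd (X Y : CGTop.{u}) : C(prod X Y, Y) :=
  @ContinuousMap.mk (X × Y) Y (kTop (X × Y)) _ Prod.snd continuous_kTop_snd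

/-- Product of maps. -/
def prodMap {X X' Y Y' : CGTop.{u}} (f : X ⟶ X') (g : Y ⟶ Y') : prod X Y ⟶ prod X' Y' :=
  lift (f.hom.comp (fst X Y)) (g.hom.comp (snd X Y))

instance : MonoidalCategoryStruct CGTop.{u} where
  tensorObj := prod
  tensorUnit := pt
  whiskerLeft X _ _ g := prodMap (𝟙 X) g
  whiskerRight f Y := prodMap f (𝟙 Y)
  tensorHom f g := prodMap f g
  associator X Y Z :=
    { hom := lift ((fst X Y).comp (fst (prod X Y) Z))
        (lift ((snd X Y).comp (fst (prod X Y) Z)) (snd (prod X Y) Z)).hom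
      inv := lift (lift (fst X (prod Y Z)) ((fst Y Z).comp (snd X (prod Y Z)))).hom
        ((snd Y Z).comp (snd X (prod Y Z)))
      hom_inv_id := rfl
      inv_hom_id := rfl }
  leftUnitor X :=
    { hom := ⟨snd pt X⟩
      inv := lift (ContinuousMap.const X PUnit.unit) (ContinuousMap.id X)
      hom_inv_id := rfl
      inv_hom_id := rfl }
  rightUnitor X :=
    { hom := ⟨fst X pt⟩
      inv := lift (ContinuousMap.id X) (ContinuousMap.const X PUnit.unit)
      hom_inv_id := rfl
      inv_hom_id := rfl }

/-- The cartesian monoidal structure on compactly generated spaces. -/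
instance : MonoidalCategory CGTop.{u} :=
  MonoidalCategory.ofTensorHom
    (id_tensorHom_id := fun _ _ => rfl)
    (id_tensorHom := fun _ _ _ _ => rfl)
    (tensorHom_id := fun _ _ => rfl)
    (tensorHom_comp_tensorHom := fun _ _ _ _ => rfl)
    (associator_naturality := fun _ _ _ => rfl)
    (leftUnitor_naturality := fun _ => rfl)
    (rightUnitor_naturality := fun _ => rfl)
    (pentagon := fun _ _ _ _ => rfl)
    (triangle := fun _ _ => rfl)

end CGTop

/-! ### Topologically enriched categories and functors -/

/-- A topological enrichment of a category: compactly generated topologies on the morphism sets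
such that composition is continuous (on the product in compactly generated spaces). -/
class TopEnriched (C : Type w) [Category.{v} C] where
  /-- The topology on morphism sets. -/
  homTop (X Y : C) : TopologicalSpace (X ⟶ Y)
  cgwh (X Y : C) : CGWHSpace (X ⟶ Y)
  continuous_comp (X Y Z : C) :
    Continuous[kTop ((X ⟶ Y) × (Y ⟶ Z)), homTop X Z] (fun p => p.1 ≫ p.2)

attribute [reducible, instance] TopEnriched.homTop
attribute [instance] TopEnriched.cgwh

/-- A functor between topologically enriched categories is topologically enriched if it is
continuous on morphism spaces. -/
def IsTopEnriched {C : Type*} [Category* C] [TopEnriched C] {D : Type*} [Category* D]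
    [TopEnriched D] (F : C ⥤ D) : Prop :=
  ∀ X Y : C, Continuous (fun f : X ⟶ Y => F.map f)

namespace CGTop

/-- If `X` is a `k`-space and `T` is compact Hausdorff, then a continuous map from `T` to
the mapping space `C(X, Y)` is jointly continuous. -/
theorem continuous_uncurry_compact {T X : Type u} {Y : Type*} [TopologicalSpace T] [CompactSpace T]
    [T2Space T] [TopologicalSpace X] [CompactlyGeneratedSpace X] [TopologicalSpace Y]
    (g : T → C(X, Y)) (hg : Continuous g) : Continuous (fun p : T × X => g p.1 p.2) := by
  have key : ∀ (K : Type u) [TopologicalSpace K] [CompactSpace K] [T2Space K] (k : K → X),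
      Continuous k → Continuous (fun p : K × T => g p.2 (k p.1)) := by
    intro K _ _ _ k hk
    have h1 : Continuous (fun t => (g t).comp ⟨k, hk⟩) := by fun_prop
    exact (ContinuousMap.continuous_uncurry_of_continuous ⟨_, h1⟩).comp continuous_swap
  have hx : ∀ x, Continuous fun t => g t x := fun x => by fun_prop
  have h2 : Continuous (fun x : X => (⟨fun t => g t x, hx x⟩ : C(T, Y))) := by
    refine continuous_from_compactlyGeneratedSpace _ fun K _ _ _ k hk => ?_
    exact (ContinuousMap.curry ⟨_, key K k hk⟩).continuous
  exact (ContinuousMap.continuous_uncurry_of_continuous ⟨_, h2⟩).comp continuous_swap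

/-- The mapping space in compactly generated spaces: the `k`-ification of the compact-open
topology. -/
instance mapTop (X Y : CGTop.{u}) : TopologicalSpace (X ⟶ Y) :=
  (kTop C(X, Y)).induced Hom.hom

theorem continuous_hom (X Y : CGTop.{u}) :
    Continuous (fun f : X ⟶ Y => (f.hom : C(X, Y))) :=
  @Continuous.comp _ _ _ _ (kTop C(X, Y)) _ _ _
    (continuous_kTop_id (tX := ContinuousMap.compactOpen)) (@continuous_induced_dom _ _ _ (kTop _))

/-- `X ⟶ Y` is the `k`-ified mapping space. -/
def homHomeo (X Y : CGTop.{u}) : @Homeomorph (X ⟶ Y) C(X, Y) _ (kTop C(X, Y)) :=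
  letI := kTop C(X, Y)
  { toFun := Hom.hom
    invFun := Hom.mk
    left_inv := fun _ => rfl
    right_inv := fun _ => rfl
    continuous_toFun := continuous_induced_dom
    continuous_invFun := continuous_induced_rng.2 continuous_id }

instance (X Y : CGTop.{u}) : CompactlyGeneratedSpace (X ⟶ Y) :=
  @compactlyGeneratedSpace_of_coinduced C(X, Y) (kTop C(X, Y)) (X ⟶ Y) _
    compactlyGeneratedSpace_kTop _ (@Homeomorph.continuous _ _ (kTop C(X, Y)) _
      (@Homeomorph.symm _ _ _ (kTop C(X, Y)) (homHomeo X Y)))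
    (by
      have := @Homeomorph.coinduced_eq _ _ (kTop C(X, Y)) _
        (@Homeomorph.symm _ _ _ (kTop C(X, Y)) (homHomeo X Y))
      exact this.symm)

instance : TopEnriched CGTop.{u} where
  homTop := mapTop
  cgwh X Y := CGWHSpace.of_coincidence fun S K _ _ _ _ _ _ g f hg hf => by
    have he : ∀ x : X, Continuous (fun f : X ⟶ Y => f.hom x) := fun x =>
      (ContinuousEvalConst.continuous_eval_const x).comp (continuous_hom X Y)
    have h1 : {q : S × K | g q.1 = f q.2} = ⋂ x : X, {q | (g q.1).hom x = (f q.2).hom x} := by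
      ext q
      simp only [Set.mem_iInter]
      exact ⟨fun h x => congrArg (fun k : X ⟶ Y => k.hom x) h,
        fun h => Hom.ext (ContinuousMap.ext h)⟩
    rw [h1]
    exact isClosed_iInter fun x =>
      WeakHausdorffSpace.isClosed_coincidence ((he x).comp hg) ((he x).comp hf)
  continuous_comp X Y Z := by
    refine continuous_from_compactlyGenerated.{u} _ fun S g => ?_
    refine continuous_induced_rng.2 (continuous_kTop_of_compact (tX := ContinuousMap.compactOpen) ?_)
    have h1 := continuous_uncurry_compact (fun s => (g s).1.hom)
      ((continuous_hom X Y).comp (continuous_fst.comp g.continuous))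
    have h2 := continuous_uncurry_compact (fun s => (g s).2.hom)
      ((continuous_hom Y Z).comp (continuous_snd.comp g.continuous))
    exact (ContinuousMap.curry ⟨fun p : S × X => (g p.1).2.hom ((g p.1).1.hom p.2),
      h2.comp (continuous_fst.prodMk h1)⟩).continuous

end CGTop
end QST

namespace QST

/-! ### Finite-dimensional Hilbert spaces and isometries -/

/-- Non-zero finite-dimensional complex Hilbert spaces; the morphisms are linear isometries. -/
structure HilbFin : Type 1 where
  of ::
  /-- The underlying vector space. -/
  carrier : Type
  [normed : NormedAddCommGroup carrier]
  [inner : InnerProductSpace ℂ carrier]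
  [finite : FiniteDimensional ℂ carrier]
  [nontrivial : Nontrivial carrier]

namespace HilbFin

instance : CoeSort HilbFin Type := ⟨carrier⟩

attribute [instance] normed inner finite nontrivial

/-- Morphisms are linear isometric embeddings. -/
@[ext] structure Hom (H K : HilbFin) where
  /-- The underlying isometry. -/
  hom : H →ₗᵢ[ℂ] K

instance : Category HilbFin where
  Hom := Hom
  id H := ⟨LinearIsometry.id⟩
  comp f g := ⟨g.hom.comp f.hom⟩

instance : ConcreteCategory HilbFin (fun H K => H →ₗᵢ[ℂ] K) where
  hom := Hom.hom
  ofHom := Hom.mk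

/-- Unitary equivalences are isomorphisms. -/
def isoOfEquiv {H K : HilbFin} (e : H ≃ₗᵢ[ℂ] K) : H ≅ K where
  hom := ⟨e.toLinearIsometry⟩
  inv := ⟨e.symm.toLinearIsometry⟩
  hom_inv_id := Hom.ext (LinearIsometry.ext fun x => e.symm_apply_apply x)
  inv_hom_id := Hom.ext (LinearIsometry.ext fun x => e.apply_symm_apply x)

instance : MonoidalCategoryStruct HilbFin where
  tensorObj H K := of (H ⊗[ℂ] K)
  tensorUnit := of ℂ
  whiskerLeft _ _ _ g := ⟨TensorProduct.mapIsometry LinearIsometry.id g.hom⟩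
  whiskerRight f _ := ⟨TensorProduct.mapIsometry f.hom LinearIsometry.id⟩
  tensorHom f g := ⟨TensorProduct.mapIsometry f.hom g.hom⟩
  associator H K L := isoOfEquiv (TensorProduct.assocIsometry ℂ H K L)
  leftUnitor H := isoOfEquiv (TensorProduct.lidIsometry ℂ H)
  rightUnitor H := isoOfEquiv (TensorProduct.ridIsometry ℂ H)

theorem hom_ext_toLinearMap {H K : HilbFin} {f g : H ⟶ K}
    (h : f.hom.toLinearMap = g.hom.toLinearMap) : f = g :=
  Hom.ext (LinearIsometry.toLinearMap_injective h)

/-- The monoidal structure given by the tensor product of Hilbert spaces. -/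
instance : MonoidalCategory HilbFin :=
  MonoidalCategory.ofTensorHom
    (id_tensorHom_id := fun _ _ => hom_ext_toLinearMap (TensorProduct.ext' fun _ _ => rfl))
    (id_tensorHom := fun _ _ _ _ => rfl)
    (tensorHom_id := fun _ _ => rfl)
    (tensorHom_comp_tensorHom := fun _ _ _ _ =>
      hom_ext_toLinearMap (TensorProduct.ext' fun _ _ => rfl))
    (associator_naturality := fun _ _ _ =>
      hom_ext_toLinearMap (TensorProduct.ext_threefold fun _ _ _ => rfl))
    (leftUnitor_naturality := fun f =>
      hom_ext_toLinearMap (TensorProduct.ext' fun c x =>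
        (LinearMap.map_smul f.hom.toLinearMap (show ℂ from c) x).symm))
    (rightUnitor_naturality := fun f =>
      hom_ext_toLinearMap (TensorProduct.ext' fun x c =>
        (LinearMap.map_smul f.hom.toLinearMap (show ℂ from c) x).symm))
    (pentagon := fun _ _ _ _ =>
      hom_ext_toLinearMap (TensorProduct.ext_fourfold fun _ _ _ _ => rfl))
    (triangle := fun _ _ =>
      hom_ext_toLinearMap (TensorProduct.ext_threefold fun x c y =>
        (TensorProduct.smul_tmul (show ℂ from c) x y).symm))

/-- The set of isometries carries the subspace topology from the space of bounded linear maps. -/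
instance isoTop (H K : HilbFin) : TopologicalSpace (H ⟶ K) :=
  TopologicalSpace.induced (fun f => f.hom.toContinuousLinearMap) inferInstance

theorem isEmbedding_toCLM (H K : HilbFin) :
    IsEmbedding (fun f : H ⟶ K => f.hom.toContinuousLinearMap) :=
  ⟨⟨rfl⟩, fun _ _ h => Hom.ext (LinearIsometry.ext fun x => DFunLike.congr_fun h x)⟩

instance (H K : HilbFin) : T2Space (H ⟶ K) := (isEmbedding_toCLM H K).t2Space

instance (H K : HilbFin) : FirstCountableTopology (H ⟶ K) :=
  (isEmbedding_toCLM H K).isInducing.firstCountableTopology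

instance : TopEnriched HilbFin where
  homTop := isoTop
  cgwh _ _ := { }
  continuous_comp H K L := by
    have h : Continuous (fun p : (H ⟶ K) × (K ⟶ L) => p.1 ≫ p.2) := by
      refine continuous_induced_rng.2 ?_
      exact ((isEmbedding_toCLM K L).continuous.comp continuous_snd).clm_comp
        ((isEmbedding_toCLM H K).continuous.comp continuous_fst)
    exact continuous_from_compactlyGenerated.{0} _ fun _ g => h.comp g.continuous

end HilbFin

end QST

namespace QST

/-! ### Finite tensor powers of Hilbert spaces and their operators -/

instance (priority := 50) completeSpaceOfFinite (H : Type*) [NormedAddCommGroup H]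
    [InnerProductSpace ℂ H] [FiniteDimensional ℂ H] : CompleteSpace H :=
  FiniteDimensional.complete ℂ H

section TensorPower

variable (ι : Type u) [Fintype ι] (H : Type v) [NormedAddCommGroup H] [InnerProductSpace ℂ H]
  [FiniteDimensional ℂ H]

/-- The Hilbert space tensor product `⨂_{i ∈ ι} H` of copies of `H`
(a type synonym which carries the Hilbert space norm). -/
def TPow (ι : Type u) (H : Type v) [NormedAddCommGroup H] [InnerProductSpace ℂ H] :
    Type (max u v) :=
  ⨂[ℂ] _ : ι, H

namespace TPow

instance : AddCommGroup (TPow ι H) := inferInstanceAs (AddCommGroup (⨂[ℂ] _ : ι, H))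

instance instModule : Module ℂ (TPow ι H) := inferInstanceAs (Module ℂ (⨂[ℂ] _ : ι, H))

instance instFinite : FiniteDimensional ℂ (TPow ι H) :=
  inferInstanceAs (Module.Finite ℂ (⨂[ℂ] _ : ι, H))

variable {ι H} in
/-- The elementary tensor `⨂ x_i`. -/
def tprod (x : ι → H) : TPow ι H := PiTensorProduct.tprod ℂ x

/-- The basis of elementary tensors of vectors of an orthonormal basis of `H`. -/
def basis : Module.Basis (ι → Fin (Module.finrank ℂ H)) ℂ (TPow ι H) :=
  Basis.piTensorProduct fun _ : ι => (stdOrthonormalBasis ℂ H).toBasis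

theorem basis_repr_tprod (x : ι → H) (p : ι → Fin (Module.finrank ℂ H)) :
    (basis ι H).repr (tprod x) p = ∏ i, inner ℂ (stdOrthonormalBasis ℂ H (p i)) (x i) := by
  refine (Basis.piTensorProduct_repr_tprod_apply _ _ _).trans ?_
  simp [OrthonormalBasis.repr_apply_apply]

theorem basis_apply (p : ι → Fin (Module.finrank ℂ H)) :
    basis ι H p = tprod fun i => stdOrthonormalBasis ℂ H (p i) := by
  refine (Basis.piTensorProduct_apply _ _).trans ?_
  simp [tprod]

open scoped Classical in
instance : Inner ℂ (TPow ι H) where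
  inner x y := ∑ p, starRingEnd ℂ ((basis ι H).repr x p) * (basis ι H).repr y p

open scoped Classical in
theorem inner_def (x y : TPow ι H) :
    inner ℂ x y = ∑ p, starRingEnd ℂ ((basis ι H).repr x p) * (basis ι H).repr y p := rfl

/-- The inner product is the one determined by `⟪⨂ x_i, ⨂ y_i⟫ = ∏ ⟪x_i, y_i⟫`. -/
theorem inner_tprod (x y : ι → H) :
    inner ℂ (tprod x) (tprod y) = ∏ i, inner ℂ (x i) (y i) := by
  classical
  simp_rw [inner_def, basis_repr_tprod, map_prod, ← Finset.prod_mul_distrib, inner_conj_symm]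
  have h := Finset.prod_univ_sum (fun _ : ι => Finset.univ)
    (fun i (j : Fin (Module.finrank ℂ H)) =>
      inner ℂ (x i) (stdOrthonormalBasis ℂ H j) * inner ℂ (stdOrthonormalBasis ℂ H j) (y i))
  rw [Fintype.piFinset_univ] at h
  rw [← h]
  simp [OrthonormalBasis.sum_inner_mul_inner]

/-- The inner product core of the tensor power. -/
abbrev core : InnerProductSpace.Core ℂ (TPow ι H) where
  conj_inner_symm x y := by simp [inner_def, mul_comm]
  re_inner_nonneg x := by
    simp only [inner_def, Complex.conj_mul', map_sum]
    exact Finset.sum_nonneg fun p _ => by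
      rw [← Complex.ofReal_pow]
      exact sq_nonneg _
  add_left x y z := by simp [inner_def, add_mul, Finset.sum_add_distrib]
  smul_left x y r := by simp [inner_def, mul_assoc, Finset.mul_sum]
  definite x h := by
    classical
    simp only [inner_def, Complex.conj_mul'] at h
    have h2 : ∑ p, ‖(basis ι H).repr x p‖ ^ 2 = 0 := by exact_mod_cast h
    rw [Finset.sum_eq_zero_iff_of_nonneg fun _ _ => sq_nonneg _] at h2
    refine (basis ι H).ext_elem fun p => ?_
    simpa using h2 p (Finset.mem_univ p)

instance instNormed : NormedAddCommGroup (TPow ι H) := (core ι H).toNormedAddCommGroup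

instance instInnerProductSpace : InnerProductSpace ℂ (TPow ι H) := .ofCore (core ι H).toCore

instance [Nontrivial H] : Nontrivial (TPow ι H) := by
  obtain ⟨x, hx⟩ := exists_ne (0 : H)
  refine ⟨⟨tprod fun _ => x, 0, fun h => ?_⟩⟩
  have := inner_tprod ι H (fun _ => x) (fun _ => x)
  rw [h, inner_zero_left] at this
  exact Finset.prod_ne_zero_iff.2 (fun i _ => inner_self_ne_zero.2 hx) this.symm

variable {ι H}

theorem linearMap_ext {E : Type*} [AddCommMonoid E] [Module ℂ E] {f g : TPow ι H →ₗ[ℂ] E}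
    (h : ∀ x : ι → H, f (tprod x) = g (tprod x)) : f = g :=
  PiTensorProduct.ext (MultilinearMap.ext h)

theorem ext_inner {x y : TPow ι H} (h : ∀ z : ι → H, inner ℂ x (tprod z) = inner ℂ y (tprod z)) :
    x = y := by
  have : (innerSL ℂ x).toLinearMap = (innerSL ℂ y).toLinearMap := linearMap_ext h
  exact ext_inner_right ℂ fun z => DFunLike.congr_fun this z

end TPow

variable {ι H}
variable {K : Type*} [NormedAddCommGroup K] [InnerProductSpace ℂ K] [FiniteDimensional ℂ K]
variable {L : Type*} [NormedAddCommGroup L] [InnerProductSpace ℂ L] [FiniteDimensional ℂ L]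

/-- The operator `⨂_i a_i : ⨂_i H → ⨂_i K`. -/
def tensorOp (a : ι → (H →L[ℂ] K)) : TPow ι H →L[ℂ] TPow ι K :=
  LinearMap.toContinuousLinearMap
    (show TPow ι H →ₗ[ℂ] TPow ι K from PiTensorProduct.map fun i => (a i : H →ₗ[ℂ] K))

theorem tensorOp_tprod (a : ι → (H →L[ℂ] K)) (x : ι → H) :
    tensorOp a (TPow.tprod x) = TPow.tprod fun i => a i (x i) :=
  PiTensorProduct.map_tprod _ _

theorem clm_ext {E : Type*} [NormedAddCommGroup E] [NormedSpace ℂ E] {f g : TPow ι H →L[ℂ] E}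
    (h : ∀ x : ι → H, f (TPow.tprod x) = g (TPow.tprod x)) : f = g :=
  ContinuousLinearMap.coe_injective (TPow.linearMap_ext h)

theorem tensorOp_comp (b : ι → (K →L[ℂ] L)) (a : ι → (H →L[ℂ] K)) :
    tensorOp b ∘L tensorOp a = tensorOp fun i => b i ∘L a i :=
  clm_ext fun x => by simp [tensorOp_tprod]

theorem tensorOp_id : tensorOp (fun _ : ι => ContinuousLinearMap.id ℂ H) = .id ℂ _ :=
  clm_ext fun x => by simp [tensorOp_tprod]

theorem adjoint_tensorOp (a : ι → (H →L[ℂ] K)) :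
    (tensorOp a).adjoint = tensorOp fun i => (a i).adjoint := by
  refine clm_ext fun x => TPow.ext_inner fun z => ?_
  rw [ContinuousLinearMap.adjoint_inner_left, tensorOp_tprod, tensorOp_tprod, TPow.inner_tprod,
    TPow.inner_tprod]
  simp [ContinuousLinearMap.adjoint_inner_left]

/-- `⨂_i a_i` as a multilinear map in the family `a`. -/
def tensorOpMultilinear :
    MultilinearMap ℂ (fun _ : ι => H →L[ℂ] H) (TPow ι H →L[ℂ] TPow ι H) :=
  (LinearMap.toContinuousLinearMap (𝕜 := ℂ) (E := TPow ι H)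
      (F' := TPow ι H)).toLinearMap.compMultilinearMap
    ((show MultilinearMap ℂ (fun _ : ι => H →ₗ[ℂ] H) (TPow ι H →ₗ[ℂ] TPow ι H) from
      PiTensorProduct.mapMultilinear ℂ (fun _ : ι => H) (fun _ : ι => H)).compLinearMap
        fun _ => ContinuousLinearMap.coeLM ℂ)

theorem tensorOpMultilinear_apply (a : ι → (H →L[ℂ] H)) :
    tensorOpMultilinear a = tensorOp a := rfl

/-- The linear map `⨂_i B(H) → B(⨂_i H)`. -/
def opMap : (⨂[ℂ] _ : ι, (H →L[ℂ] H)) →ₗ[ℂ] (TPow ι H →L[ℂ] TPow ι H) :=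
  PiTensorProduct.lift tensorOpMultilinear

theorem opMap_tprod (a : ι → (H →L[ℂ] H)) : opMap (PiTensorProduct.tprod ℂ a) = tensorOp a :=
  PiTensorProduct.lift.tprod _

/-- The operators `⨂_i a_i` span `B(⨂_i H)`. -/
theorem opMap_surjective : Function.Surjective (opMap (ι := ι) (H := H)) := by
  classical
  rw [← LinearMap.range_eq_top, eq_top_iff]
  rintro T -
  let e := stdOrthonormalBasis ℂ H
  let E : (ι → Fin (Module.finrank ℂ H)) → (ι → Fin (Module.finrank ℂ H)) →
      (TPow ι H →L[ℂ] TPow ι H) :=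
    fun p q => tensorOp fun i => (innerSL ℂ (e (q i))).smulRight (e (p i))
  have hE : ∀ p q x, E p q x = (TPow.basis ι H).repr x q • TPow.basis ι H p := by
    intro p q
    have : E p q = LinearMap.toContinuousLinearMap
        (((TPow.basis ι H).coord q).smulRight (TPow.basis ι H p)) := by
      refine clm_ext fun x => ?_
      rw [tensorOp_tprod]
      simp only [LinearMap.coe_toContinuousLinearMap', LinearMap.smulRight_apply,
        Module.Basis.coord_apply, TPow.basis_repr_tprod, TPow.basis_apply]
      exact (PiTensorProduct.tprod ℂ).map_smul_univ _ _
    intro x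
    rw [this]
    rfl
  have hT : T = ∑ q, ∑ p, (TPow.basis ι H).repr (T (TPow.basis ι H q)) p • E p q := by
    refine ContinuousLinearMap.coe_injective ((TPow.basis ι H).ext fun r => ?_)
    simp only [ContinuousLinearMap.coe_coe, sum_apply,
      smul_apply, hE, Module.Basis.repr_self]
    rw [Finset.sum_eq_single r]
    · simp [Module.Basis.sum_repr]
    · intro q _ hq
      simp [hq.symm]
    · simp
  rw [hT]
  refine Submodule.sum_mem _ fun q _ => Submodule.sum_mem _ fun p _ => Submodule.smul_mem _ _ ?_
  exact ⟨_, opMap_tprod _⟩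

theorem opMap_bijective : Function.Bijective (opMap (ι := ι) (H := H)) := by
  classical
  have h : Module.finrank ℂ (⨂[ℂ] _ : ι, (H →L[ℂ] H)) =
      Module.finrank ℂ (TPow ι H →L[ℂ] TPow ι H) := by
    rw [Module.finrank_eq_card_basis
      (Basis.piTensorProduct fun _ : ι => Module.finBasis ℂ (H →L[ℂ] H)),
      ← (LinearMap.toContinuousLinearMap (𝕜 := ℂ) (E := TPow ι H)
        (F' := TPow ι H)).finrank_eq, Module.finrank_linearMap,
      Module.finrank_eq_card_basis (TPow.basis ι H)]
    simp only [Fintype.card_pi, Fintype.card_fin, Finset.prod_const]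
    rw [← (LinearMap.toContinuousLinearMap (𝕜 := ℂ) (E := H) (F' := H)).finrank_eq,
      Module.finrank_linearMap, mul_pow]
  exact ⟨(LinearMap.injective_iff_surjective_of_finrank_eq_finrank h).2 opMap_surjective,
    opMap_surjective⟩

/-- The canonical isomorphism `⨂_i B(H) ≃ B(⨂_i H)`. -/
def opEquiv : (⨂[ℂ] _ : ι, (H →L[ℂ] H)) ≃ₗ[ℂ] (TPow ι H →L[ℂ] TPow ι H) :=
  LinearEquiv.ofBijective opMap opMap_bijective

theorem opEquiv_symm_tensorOp (a : ι → (H →L[ℂ] H)) :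
    opEquiv.symm (tensorOp a) = PiTensorProduct.tprod ℂ a := by
  rw [LinearEquiv.symm_apply_eq]
  exact (opMap_tprod a).symm

theorem op_linearMap_ext {E : Type*} [AddCommMonoid E] [Module ℂ E]
    {f g : (TPow ι H →L[ℂ] TPow ι H) →ₗ[ℂ] E}
    (h : ∀ a : ι → (H →L[ℂ] H), f (tensorOp a) = g (tensorOp a)) : f = g := by
  have : f ∘ₗ opMap = g ∘ₗ opMap := PiTensorProduct.ext (MultilinearMap.ext fun a => by
    simpa [opMap_tprod] using h a)
  ext1 T
  obtain ⟨t, rfl⟩ := opMap_surjective T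
  exact DFunLike.congr_fun this t

/-- The linear map out of `B(⨂_i H)` with prescribed (multilinear) values on the operators
`⨂_i a_i`. -/
def opLift {E : Type*} [AddCommMonoid E] [Module ℂ E]
    (m : MultilinearMap ℂ (fun _ : ι => H →L[ℂ] H) E) : (TPow ι H →L[ℂ] TPow ι H) →ₗ[ℂ] E :=
  PiTensorProduct.lift m ∘ₗ opEquiv.symm.toLinearMap

theorem opLift_tensorOp {E : Type*} [AddCommMonoid E] [Module ℂ E]
    (m : MultilinearMap ℂ (fun _ : ι => H →L[ℂ] H) E) (a : ι → (H →L[ℂ] H)) :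
    opLift m (tensorOp a) = m a := by
  simp [opLift, opEquiv_symm_tensorOp]

theorem tensorOp_mul (a b : ι → (H →L[ℂ] H)) :
    tensorOp a * tensorOp b = tensorOp (a * b) := tensorOp_comp a b

theorem tensorOp_one : tensorOp (1 : ι → (H →L[ℂ] H)) = 1 := tensorOp_id

theorem star_tensorOp (a : ι → (H →L[ℂ] H)) : star (tensorOp a) = tensorOp (star a) :=
  adjoint_tensorOp a

/-- The `*`-homomorphism out of `B(⨂_i H)` with prescribed values on the operators `⨂_i a_i`. -/
def opLiftStar {E : Type*} [Ring E] [Algebra ℂ E] [StarRing E] [StarModule ℂ E]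
    (m : MultilinearMap ℂ (fun _ : ι => H →L[ℂ] H) E) (hone : m 1 = 1)
    (hmul : ∀ a b, m (a * b) = m a * m b) (hstar : ∀ a, m (star a) = star (m a)) :
    (TPow ι H →L[ℂ] TPow ι H) →⋆ₐ[ℂ] E :=
  { AlgHom.ofLinearMap (opLift m) (by rw [← tensorOp_one, opLift_tensorOp, hone])
      (by
        have : (LinearMap.mul ℂ _).compr₂ (opLift m) =
            (LinearMap.mul ℂ E).compl₁₂ (opLift m) (opLift m) :=
          op_linearMap_ext fun a => op_linearMap_ext fun b => by
            simp [tensorOp_mul, opLift_tensorOp, hmul]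
        exact fun S T => DFunLike.congr_fun (DFunLike.congr_fun this S) T) with
    map_star' := by
      intro T
      have : (starLinearEquiv ℂ (A := E)).symm.toLinearMap ∘ₛₗ opLift m ∘ₛₗ
          (starLinearEquiv ℂ (A := TPow ι H →L[ℂ] TPow ι H)).toLinearMap = opLift m :=
        op_linearMap_ext fun a => by
          simp [star_tensorOp, opLift_tensorOp, hstar]
      have h2 := DFunLike.congr_fun this T
      have h3 := congrArg star h2
      have h4 : opLift m (star T) = star (opLift m T) := by simpa using h3
      exact h4 }

theorem opLiftStar_tensorOp {E : Type*} [Ring E] [Algebra ℂ E] [StarRing E] [StarModule ℂ E]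
    (m : MultilinearMap ℂ (fun _ : ι => H →L[ℂ] H) E) (hone : m 1 = 1)
    (hmul : ∀ a b, m (a * b) = m a * m b) (hstar : ∀ a, m (star a) = star (m a))
    (a : ι → (H →L[ℂ] H)) : opLiftStar m hone hmul hstar (tensorOp a) = m a :=
  opLift_tensorOp m a

end TensorPower

end QST

namespace QST

/-! ### Colimits of directed systems of C*-algebras -/

/-- A directed system of (unital) C*-algebras and isometric unital `*`-homomorphisms. -/
structure CStarSystem (ι : Type u) [Preorder ι] where
  /-- The algebras. -/
  alg : ι → Type v
  [cstar : ∀ i, CStarAlgebra (alg i)]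
  /-- The transition maps. -/
  map : ∀ ⦃i j : ι⦄, i ≤ j → alg i →⋆ₐ[ℂ] alg j
  map_refl : ∀ i (a : alg i), map le_rfl a = a
  map_trans : ∀ ⦃i j k⦄ (h : i ≤ j) (h' : j ≤ k) (a : alg i),
    map h' (map h a) = map (h.trans h') a
  norm_map : ∀ ⦃i j⦄ (h : i ≤ j) (a : alg i), ‖map h a‖ = ‖a‖

namespace CStarSystem

attribute [instance] cstar

variable {ι : Type u} [Preorder ι] [IsDirectedOrder ι] [Nonempty ι] (S : CStarSystem.{u, v} ι)

instance : DirectedSystem S.alg (fun _ _ h => ⇑(S.map h)) where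
  map_self := S.map_refl
  map_map := fun _ _ _ h h' a => S.map_trans h h' a

/-- The algebraic direct limit, i.e. the union of the algebras of the system. -/
def Union : Type (max u v) := DirectLimit S.alg (fun _ _ h => S.map h)

namespace Union

variable {S}

/-- The inclusion of an algebra of the system into the direct limit. -/
def of (i : ι) (a : S.alg i) : S.Union :=
  (⟦⟨i, a⟩⟧ : DirectLimit S.alg (fun _ _ h => S.map h))

theorem of_map {i j : ι} (h : i ≤ j) (a : S.alg i) : of j (S.map h a) = of i a :=
  DirectLimit.mk_apply (f := fun _ _ h => S.map h) _ _ _ h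

theorem induction {C : S.Union → Prop} (h : ∀ i a, C (of i a)) (x : S.Union) : C x :=
  DirectLimit.induction _ h x

theorem induction₂ {C : S.Union → S.Union → Prop}
    (h : ∀ i a b, C (of i a) (of i b)) (x y : S.Union) : C x y :=
  DirectLimit.induction₂ _ h x y

instance : Ring S.Union := inferInstanceAs (Ring (DirectLimit S.alg (fun _ _ h => S.map h)))

instance : Algebra ℂ S.Union :=
  inferInstanceAs (Algebra ℂ (DirectLimit S.alg (fun _ _ h => S.map h)))

instance : StarRing S.Union :=
  inferInstanceAs (StarRing (DirectLimit S.alg (fun _ _ h => S.map h)))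

theorem of_one (i : ι) : of i (1 : S.alg i) = 1 :=
  (DirectLimit.one_def (f := fun _ _ h => S.map h) i).symm

theorem of_zero (i : ι) : of i (0 : S.alg i) = 0 :=
  (DirectLimit.zero_def (f := fun _ _ h => S.map h) i).symm

theorem of_add {i : ι} (a b : S.alg i) : of i (a + b) = of i a + of i b :=
  (DirectLimit.add_def (f := fun _ _ h => S.map h) i a b).symm

theorem of_neg {i : ι} (a : S.alg i) : of i (-a) = -of i a :=
  (DirectLimit.neg_def (f := fun _ _ h => S.map h) i a).symm

theorem of_mul {i : ι} (a b : S.alg i) : of i (a * b) = of i a * of i b :=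
  (DirectLimit.mul_def (f := fun _ _ h => S.map h) i a b).symm

theorem of_smul {i : ι} (c : ℂ) (a : S.alg i) : of i (c • a) = c • of i a :=
  (DirectLimit.smul_def (f := fun _ _ h => S.map h) i a c).symm

theorem of_star {i : ι} (a : S.alg i) : of i (star a) = star (of i a) :=
  (DirectLimit.star_def (f := fun _ _ h => S.map h) i a).symm

instance : StarModule ℂ S.Union where
  star_smul c := induction fun i a => by
    rw [← of_smul, ← of_star, ← of_star, ← of_smul, star_smul]

/-- The norm of the direct limit. -/
def norm : S.Union → ℝ :=
  DirectLimit.lift _ (fun _ a => ‖a‖) fun _ _ h a => (S.norm_map h a).symm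

/-- The norm of the direct limit, bundled. -/
def ringNorm : RingNorm S.Union where
  toFun := norm
  map_zero' := by
    rw [← of_zero (Classical.arbitrary ι)]
    exact norm_zero
  add_le' := induction₂ fun i a b => by
    rw [← of_add]
    exact norm_add_le a b
  neg' := induction fun i a => by
    rw [← of_neg]
    exact norm_neg a
  mul_le' := induction₂ fun i a b => by
    rw [← of_mul]
    exact norm_mul_le a b
  eq_zero_of_map_eq_zero' := induction fun i a ha => by
    rw [norm_eq_zero.1 (show ‖a‖ = 0 from ha), of_zero]

instance : NormedRing S.Union := ringNorm.toNormedRing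

theorem norm_of (i : ι) (a : S.alg i) : ‖of i a‖ = ‖a‖ := rfl

instance : NormedAlgebra ℂ S.Union where
  norm_smul_le c := induction fun i a => by
    rw [← of_smul, norm_of, norm_of, norm_smul]

instance : CStarRing S.Union where
  norm_mul_self_le := induction fun i a => by
    rw [← of_star, ← of_mul, norm_of, norm_of, CStarRing.norm_star_mul_self]

end Union

end CStarSystem

namespace CStarSystem

open UniformSpace

variable {ι : Type u} [Preorder ι] [IsDirectedOrder ι] [Nonempty ι] (S : CStarSystem.{u, v} ι)

/-- The C*-algebraic colimit of the system: the completion of the algebraic direct limit. -/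
def Colim : Type (max u v) := Completion S.Union

namespace Colim

variable {S}

instance : NormedRing S.Colim := inferInstanceAs (NormedRing (Completion S.Union))

instance : CompleteSpace S.Colim := inferInstanceAs (CompleteSpace (Completion S.Union))

instance : Algebra ℂ S.Colim := inferInstanceAs (Algebra ℂ (Completion S.Union))

instance : NormedAlgebra ℂ S.Colim where
  norm_smul_le c x := norm_smul_le (β := Completion S.Union) c x

/-- The inclusion of the algebraic direct limit. -/
def ofUnion (x : S.Union) : S.Colim := (x : Completion S.Union)

theorem continuous_ofUnion : Continuous (ofUnion (S := S)) := Completion.continuous_coe _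

theorem ofUnion_mul (x y : S.Union) : ofUnion (x * y) = ofUnion x * ofUnion y :=
  Completion.coe_mul x y

theorem ofUnion_add (x y : S.Union) : ofUnion (x + y) = ofUnion x + ofUnion y :=
  Completion.coe_add x y

theorem ofUnion_one : ofUnion (1 : S.Union) = 1 := Completion.coe_one _

theorem ofUnion_smul (c : ℂ) (x : S.Union) : ofUnion (c • x) = c • ofUnion x :=
  Completion.coe_smul c x

theorem norm_ofUnion (x : S.Union) : ‖ofUnion x‖ = ‖x‖ := Completion.norm_coe x

theorem induction {p : S.Colim → Prop} (hp : IsClosed {x | p x}) (h : ∀ x, p (ofUnion x))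
    (x : S.Colim) : p x :=
  Completion.induction_on x hp h

theorem induction₂ {p : S.Colim → S.Colim → Prop}
    (hp : IsClosed {x : S.Colim × S.Colim | p x.1 x.2})
    (h : ∀ x y, p (ofUnion x) (ofUnion y)) (x y : S.Colim) : p x y :=
  Completion.induction_on₂ x y hp h

instance : Star S.Colim where
  star := Completion.map (star : S.Union → S.Union)

theorem uniformContinuous_star : UniformContinuous (star : S.Union → S.Union) :=
  star_isometry.uniformContinuous

theorem ofUnion_star (x : S.Union) : ofUnion (star x) = star (ofUnion x) :=
  (Completion.map_coe uniformContinuous_star x).symm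

instance : ContinuousStar S.Colim where
  continuous_star := Completion.continuous_map

instance : StarRing S.Colim where
  star_involutive := induction
    (isClosed_eq (continuous_star.comp continuous_star) continuous_id) fun x => by
      rw [← ofUnion_star, ← ofUnion_star, star_star]
  star_mul := induction₂ (isClosed_eq (by fun_prop) (by fun_prop)) fun x y => by
    rw [← ofUnion_mul, ← ofUnion_star, ← ofUnion_star, ← ofUnion_star, star_mul, ofUnion_mul]
  star_add := induction₂ (isClosed_eq (by fun_prop) (by fun_prop)) fun x y => by
    rw [← ofUnion_add, ← ofUnion_star, ← ofUnion_star, ← ofUnion_star, star_add, ofUnion_add]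

instance : StarModule ℂ S.Colim where
  star_smul c := induction (isClosed_eq (continuous_star.comp (continuous_const_smul c))
      ((continuous_const_smul (star c)).comp continuous_star)) fun x => by
    rw [← ofUnion_smul, ← ofUnion_star, ← ofUnion_star, star_smul, ofUnion_smul]

instance : CStarRing S.Colim where
  norm_mul_self_le := induction (isClosed_le (by fun_prop) (by fun_prop)) fun x => by
    rw [← ofUnion_star, ← ofUnion_mul, norm_ofUnion, norm_ofUnion, CStarRing.norm_star_mul_self]

instance : CStarAlgebra S.Colim where

/-- The canonical map `ι_i` from an algebra of the system to the colimit. -/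
def incl (S : CStarSystem.{u, v} ι) (i : ι) : S.alg i →⋆ₐ[ℂ] S.Colim where
  toFun a := ofUnion (Union.of i a)
  map_one' := by rw [Union.of_one, ofUnion_one]
  map_mul' a b := by rw [Union.of_mul, ofUnion_mul]
  map_zero' := by
    rw [Union.of_zero]
    exact Completion.coe_zero
  map_add' a b := by rw [Union.of_add, ofUnion_add]
  commutes' c := by
    rw [Algebra.algebraMap_eq_smul_one, Union.of_smul, Union.of_one, ofUnion_smul, ofUnion_one,
      Algebra.algebraMap_eq_smul_one]
  map_star' a := by rw [Union.of_star, ofUnion_star]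

theorem incl_map {i j : ι} (h : i ≤ j) (a : S.alg i) : incl S j (S.map h a) = incl S i a :=
  congrArg ofUnion (Union.of_map h a)

theorem norm_incl (i : ι) (a : S.alg i) : ‖incl S i a‖ = ‖a‖ := norm_ofUnion _

/-- Two continuous maps on the colimit agree if they agree on each algebra of the system. -/
theorem hom_ext {X : Type*} [TopologicalSpace X] [T2Space X] {f g : S.Colim → X}
    (hf : Continuous f) (hg : Continuous g) (h : ∀ i a, f (incl S i a) = g (incl S i a)) :
    f = g :=
  funext (induction (isClosed_eq hf hg) (Union.induction h))

section desc

variable {B : Type*} [NormedAddCommGroup B] [NormedSpace ℂ B] [CompleteSpace B]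

/-- The linear map out of the direct limit defined by a compatible family of linear maps. -/
def unionDesc (φ : ∀ i, S.alg i →ₗ[ℂ] B)
    (hφ : ∀ ⦃i j⦄ (h : i ≤ j) a, φ j (S.map h a) = φ i a) : S.Union →ₗ[ℂ] B where
  toFun := DirectLimit.lift _ (fun i a => φ i a) fun _ _ h a => (hφ h a).symm
  map_add' := Union.induction₂ fun i a b => by
    rw [← Union.of_add]
    exact map_add (φ i) a b
  map_smul' c := Union.induction fun i a => by
    rw [← Union.of_smul]
    exact map_smul (φ i) c a

/-- The bounded linear map out of the colimit with prescribed restrictions `φ_i` to the algebras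
of the system, for a compatible family of contractions `φ_i`. -/
def desc (φ : ∀ i, S.alg i →ₗ[ℂ] B) (hφ : ∀ ⦃i j⦄ (h : i ≤ j) a, φ j (S.map h a) = φ i a)
    (hc : ∀ i a, ‖φ i a‖ ≤ ‖a‖) : S.Colim →L[ℂ] B :=
  ((unionDesc φ hφ).mkContinuous 1 (Union.induction fun i a => by
    rw [one_mul]
    exact hc i a)).extend (Completion.toComplL : S.Union →L[ℂ] Completion S.Union)

theorem desc_incl (φ : ∀ i, S.alg i →ₗ[ℂ] B)
    (hφ : ∀ ⦃i j⦄ (h : i ≤ j) a, φ j (S.map h a) = φ i a)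
    (hc : ∀ i a, ‖φ i a‖ ≤ ‖a‖) (i : ι) (a : S.alg i) : desc φ hφ hc (incl S i a) = φ i a :=
  ContinuousLinearMap.extend_eq _ (e := (Completion.toComplL : S.Union →L[ℂ] Completion S.Union))
    Completion.denseRange_coe (Completion.isUniformInducing_coe _) (Union.of i a)

end desc

end Colim

end CStarSystem

end QST

namespace QST

/-! ### The quasi-local algebra -/

section QuasiLocal

variable {Γ : Type u} {H : Type v} [NormedAddCommGroup H] [InnerProductSpace ℂ H]
  [FiniteDimensional ℂ H]

/-- The algebra `𝔄_Λ(H) = B(⨂_{v ∈ Λ} H)` of observables localized in the finite set `Λ`. -/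
abbrev LocAlg (Λ : Finset Γ) (H : Type v) [NormedAddCommGroup H] [InnerProductSpace ℂ H]
    [FiniteDimensional ℂ H] : Type (max u v) :=
  TPow Λ H →L[ℂ] TPow Λ H

open scoped Classical in
/-- Extend a family of operators from `Λ₁` to `Λ₂` by the identity operator. -/
def extendOne (Λ₁ Λ₂ : Finset Γ) (a : Λ₁ → (H →L[ℂ] H)) (v : Λ₂) : H →L[ℂ] H :=
  if h : (v : Γ) ∈ Λ₁ then a ⟨v, h⟩ else 1

theorem extendOne_update {Λ₁ Λ₂ : Finset Γ} [DecidableEq Λ₁] [DecidableEq Λ₂] (h : Λ₁ ≤ Λ₂)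
    (a : Λ₁ → (H →L[ℂ] H)) (i : Λ₁) (d : H →L[ℂ] H) :
    extendOne Λ₁ Λ₂ (Function.update a i d) =
      Function.update (extendOne Λ₁ Λ₂ a) ⟨i, h i.2⟩ d := by
  funext v
  by_cases hv : (v : Γ) ∈ Λ₁
  · by_cases hvi : (⟨v, hv⟩ : Λ₁) = i
    · subst hvi
      simp [extendOne, hv]
    · have h2 : v ≠ ⟨i, h i.2⟩ := fun hc => hvi (Subtype.ext (by simp [hc]))
      simp [extendOne, hv, Function.update_of_ne hvi, Function.update_of_ne h2]
  · have h2 : v ≠ ⟨i, h i.2⟩ := fun hc => hv (hc ▸ i.2)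
    simp [extendOne, hv, Function.update_of_ne h2]

/-- `a ↦ ⨂_{v ∈ Λ₁} a_v ⊗ ⨂_{v ∈ Λ₂ \ Λ₁} 1` as a multilinear map. -/
def inclMultilinear {Λ₁ Λ₂ : Finset Γ} (h : Λ₁ ≤ Λ₂) :
    MultilinearMap ℂ (fun _ : Λ₁ => H →L[ℂ] H) (LocAlg Λ₂ H) where
  toFun a := tensorOp (extendOne Λ₁ Λ₂ a)
  map_update_add' a i b c := by
    classical
    simp only [extendOne_update h]
    exact tensorOpMultilinear.map_update_add _ _ _ _
  map_update_smul' a i r b := by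
    classical
    simp only [extendOne_update h]
    exact tensorOpMultilinear.map_update_smul _ _ _ _

/-- The inclusion `ι_{Λ₂Λ₁} : 𝔄_{Λ₁}(H) → 𝔄_{Λ₂}(H)` which tensors with the identity on
`Λ₂ \ Λ₁`. -/
def incl {Λ₁ Λ₂ : Finset Γ} (h : Λ₁ ≤ Λ₂) : LocAlg Λ₁ H →⋆ₐ[ℂ] LocAlg Λ₂ H :=
  opLiftStar (inclMultilinear h)
    (by
      refine Eq.trans (congrArg tensorOp ?_) tensorOp_one
      funext v
      simp [extendOne])
    (by
      intro a b
      refine Eq.trans (congrArg tensorOp ?_) (tensorOp_mul _ _).symm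
      funext v
      by_cases hv : (v : Γ) ∈ Λ₁ <;> simp [extendOne, hv])
    (by
      intro a
      refine Eq.trans (congrArg tensorOp ?_) (star_tensorOp _).symm
      funext v
      by_cases hv : (v : Γ) ∈ Λ₁ <;> simp [extendOne, hv])

theorem incl_tensorOp {Λ₁ Λ₂ : Finset Γ} (h : Λ₁ ≤ Λ₂) (a : Λ₁ → (H →L[ℂ] H)) :
    incl h (tensorOp a) = tensorOp (extendOne Λ₁ Λ₂ a) :=
  opLiftStar_tensorOp _ _ _ _ _

theorem incl_refl (Λ : Finset Γ) (A : LocAlg Λ H) : incl le_rfl A = A := by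
  have : (incl (le_refl Λ) : LocAlg Λ H →⋆ₐ[ℂ] _).toAlgHom.toLinearMap = LinearMap.id :=
    op_linearMap_ext fun a => by
      refine (incl_tensorOp _ a).trans (congrArg tensorOp ?_)
      funext v
      simp [extendOne]
  exact DFunLike.congr_fun this A

theorem incl_trans {Λ₁ Λ₂ Λ₃ : Finset Γ} (h : Λ₁ ≤ Λ₂) (h' : Λ₂ ≤ Λ₃) (A : LocAlg Λ₁ H) :
    incl h' (incl h A) = incl (h.trans h') A := by
  have : (incl h').toAlgHom.toLinearMap ∘ₗ (incl h : LocAlg Λ₁ H →⋆ₐ[ℂ] _).toAlgHom.toLinearMap =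
      (incl (h.trans h')).toAlgHom.toLinearMap :=
    op_linearMap_ext fun a => by
      change incl h' (incl h (tensorOp a)) = incl (h.trans h') (tensorOp a)
      rw [incl_tensorOp, incl_tensorOp, incl_tensorOp]
      congr 1
      funext v
      by_cases hv : (v : Γ) ∈ Λ₁
      · simp [extendOne, hv, h hv]
      · simp [extendOne, hv]
  exact DFunLike.congr_fun this A

theorem incl_injective [Nontrivial H] {Λ₁ Λ₂ : Finset Γ} (h : Λ₁ ≤ Λ₂) :
    Function.Injective (incl (H := H) h) := by
  let V := TPow Λ₁ H
  let e : (V →L[ℂ] V) ≃+* Module.End ℂ V :=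
    { toFun := fun T => T.toLinearMap
      invFun := fun T => LinearMap.toContinuousLinearMap T
      left_inv := fun _ => rfl
      right_inv := fun _ => rfl
      map_mul' := fun _ _ => rfl
      map_add' := fun _ _ => rfl }
  let e2 := (LinearMap.toMatrixAlgEquiv (Module.finBasis ℂ V)).toRingEquiv
  have : Nonempty (Fin (Module.finrank ℂ V)) := ⟨⟨0, Module.finrank_pos⟩⟩
  let φ : Matrix (Fin (Module.finrank ℂ V)) (Fin (Module.finrank ℂ V)) ℂ →+* LocAlg Λ₂ H :=
    ((incl (H := H) h : LocAlg Λ₁ H →⋆ₐ[ℂ] _) : LocAlg Λ₁ H →+* _).comp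
      (e.trans e2).symm.toRingHom
  have hφ : Function.Injective φ := RingHom.injective φ
  intro S T hST
  have : φ ((e.trans e2) S) = φ ((e.trans e2) T) := by simpa [φ] using hST
  exact (e.trans e2).injective (hφ this)

theorem norm_incl [Nontrivial H] {Λ₁ Λ₂ : Finset Γ} (h : Λ₁ ≤ Λ₂) (A : LocAlg Λ₁ H) :
    ‖incl h A‖ = ‖A‖ :=
  NonUnitalStarAlgHom.norm_map (incl h) (incl_injective h) A

instance : IsDirectedOrder (Finset Γ) := by
  classical
  infer_instance

variable (Γ H) in
/-- The directed system of the algebras `𝔄_Λ(H)`, `Λ ⊆ Γ` finite. -/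
def latticeSystem [Nontrivial H] : CStarSystem (Finset Γ) where
  alg Λ := LocAlg Λ H
  map _ _ h := incl h
  map_refl := incl_refl
  map_trans _ _ _ := incl_trans
  norm_map _ _ := norm_incl

variable (Γ H) in
/-- The quasi-local algebra `𝔄_Γ(H)`: the C*-algebraic colimit of the algebras `𝔄_Λ(H)`. -/
abbrev QuasiLocal [Nontrivial H] : Type (max u v) := (latticeSystem Γ H).Colim

/-- The inclusion `ι_Λ : 𝔄_Λ(H) → 𝔄_Γ(H)`. -/
def localIncl [Nontrivial H] (Λ : Finset Γ) : LocAlg Λ H →⋆ₐ[ℂ] QuasiLocal Γ H :=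
  CStarSystem.Colim.incl (latticeSystem Γ H) Λ

theorem localIncl_incl [Nontrivial H] {Λ₁ Λ₂ : Finset Γ} (h : Λ₁ ≤ Λ₂) (A : LocAlg Λ₁ H) :
    localIncl Λ₂ (incl h A) = localIncl Λ₁ A :=
  CStarSystem.Colim.incl_map (S := latticeSystem Γ H) h A

theorem norm_localIncl [Nontrivial H] {Λ : Finset Γ} (A : LocAlg Λ H) :
    ‖localIncl Λ A‖ = ‖A‖ :=
  CStarSystem.Colim.norm_incl (S := latticeSystem Γ H) Λ A

variable {K : Type v} [NormedAddCommGroup K] [InnerProductSpace ℂ K] [FiniteDimensional ℂ K]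

/-! ### Functoriality of the quasi-local algebra -/

/-- The isometry `f_Λ = ⨂_{v ∈ Λ} f`. -/
def isoPow (f : H →ₗᵢ[ℂ] K) (Λ : Finset Γ) : TPow Λ H →L[ℂ] TPow Λ K :=
  tensorOp fun _ => f.toContinuousLinearMap

theorem adjoint_comp_self_of_isometry (f : H →ₗᵢ[ℂ] K) :
    f.toContinuousLinearMap.adjoint ∘L f.toContinuousLinearMap = .id ℂ H := by
  ext x
  refine ext_inner_right ℂ fun y => ?_
  simp

theorem isoPow_adjoint_comp (f : H →ₗᵢ[ℂ] K) (Λ : Finset Γ) :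
    (isoPow f Λ).adjoint ∘L isoPow f Λ = .id ℂ _ := by
  rw [isoPow, adjoint_tensorOp, tensorOp_comp]
  simp only [adjoint_comp_self_of_isometry, tensorOp_id]

theorem norm_isoPow_le (f : H →ₗᵢ[ℂ] K) (Λ : Finset Γ) : ‖isoPow f Λ‖ ≤ 1 := by
  refine ContinuousLinearMap.opNorm_le_bound _ zero_le_one fun x => ?_
  have h := ContinuousLinearMap.apply_norm_sq_eq_inner_adjoint_left (isoPow f Λ) x
  rw [isoPow_adjoint_comp] at h
  have h2 : ‖isoPow f Λ x‖ ^ 2 = ‖x‖ ^ 2 := h.trans (inner_self_eq_norm_sq (𝕜 := ℂ) x)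
  rw [one_mul]
  exact le_of_eq ((sq_eq_sq₀ (norm_nonneg _) (norm_nonneg _)).1 h2)

/-- The map `Ad(f_Λ^*) : 𝔄_Λ(K) → 𝔄_Λ(H)`, `A ↦ f_Λ^* A f_Λ`. -/
def adIso (f : H →ₗᵢ[ℂ] K) (Λ : Finset Γ) : LocAlg Λ K →ₗ[ℂ] LocAlg Λ H where
  toFun A := (isoPow f Λ).adjoint ∘L A ∘L isoPow f Λ
  map_add' A B := by
    ext x
    simp
  map_smul' c A := by
    ext x
    simp

theorem adIso_tensorOp (f : H →ₗᵢ[ℂ] K) (Λ : Finset Γ) (a : Λ → (K →L[ℂ] K)) :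
    adIso f Λ (tensorOp a) =
      tensorOp fun v => f.toContinuousLinearMap.adjoint ∘L a v ∘L f.toContinuousLinearMap := by
  change (isoPow f Λ).adjoint ∘L tensorOp a ∘L isoPow f Λ = _
  rw [isoPow, adjoint_tensorOp, tensorOp_comp, tensorOp_comp]

theorem norm_adIso_le (f : H →ₗᵢ[ℂ] K) (Λ : Finset Γ) (A : LocAlg Λ K) :
    ‖adIso f Λ A‖ ≤ ‖A‖ := by
  have h1 := ContinuousLinearMap.opNorm_comp_le (isoPow f Λ).adjoint (A ∘L isoPow f Λ)
  have h2 := ContinuousLinearMap.opNorm_comp_le A (isoPow f Λ)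
  have h3 := norm_isoPow_le f Λ
  have h4 : ‖(isoPow f Λ).adjoint‖ ≤ 1 := by simpa using h3
  calc ‖adIso f Λ A‖ ≤ ‖(isoPow f Λ).adjoint‖ * ‖A ∘L isoPow f Λ‖ := h1
    _ ≤ 1 * ‖A ∘L isoPow f Λ‖ := by gcongr
    _ ≤ 1 * (‖A‖ * ‖isoPow f Λ‖) := by gcongr
    _ ≤ 1 * (‖A‖ * 1) := by gcongr
    _ = ‖A‖ := by ring

theorem incl_adIso (f : H →ₗᵢ[ℂ] K) {Λ₁ Λ₂ : Finset Γ} (h : Λ₁ ≤ Λ₂) (A : LocAlg Λ₁ K) :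
    adIso f Λ₂ (incl h A) = incl h (adIso f Λ₁ A) := by
  have : adIso f Λ₂ ∘ₗ (incl h).toAlgHom.toLinearMap =
      (incl h).toAlgHom.toLinearMap ∘ₗ adIso f Λ₁ :=
    op_linearMap_ext fun a => by
      change adIso f Λ₂ (incl h (tensorOp a)) = incl h (adIso f Λ₁ (tensorOp a))
      rw [adIso_tensorOp, incl_tensorOp, incl_tensorOp, adIso_tensorOp]
      congr 1
      funext v
      by_cases hv : (v : Γ) ∈ Λ₁
      · simp [extendOne, hv]
      · simp only [extendOne, hv, dite_false]
        exact adjoint_comp_self_of_isometry f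
  exact DFunLike.congr_fun this A

variable (Γ) in
/-- The bounded linear map `𝔄_Γ(f) = Ad(⨂ f^*) : 𝔄_Γ(K) → 𝔄_Γ(H)` induced by an isometry
`f : H → K`. -/
def quasiLocalMap [Nontrivial H] [Nontrivial K] (f : H →ₗᵢ[ℂ] K) :
    QuasiLocal Γ K →L[ℂ] QuasiLocal Γ H :=
  CStarSystem.Colim.desc (S := latticeSystem Γ K)
    (fun Λ => (localIncl Λ).toAlgHom.toLinearMap ∘ₗ adIso f Λ)
    (fun _ Λ₂ h A => (congrArg (localIncl Λ₂) (incl_adIso f h A)).trans (localIncl_incl h _))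
    (fun Λ A => (norm_localIncl (adIso f Λ A)).trans_le (norm_adIso_le f Λ A))

/-- `𝔄_Γ(f)` is characterized by `𝔄_Γ(f) ∘ ι_Λ = ι_Λ ∘ Ad(f_Λ^*)`. -/
theorem quasiLocalMap_localIncl [Nontrivial H] [Nontrivial K] (f : H →ₗᵢ[ℂ] K)
    (Λ : Finset Γ) (A : LocAlg Λ K) :
    quasiLocalMap Γ f (localIncl Λ A) = localIncl Λ (adIso f Λ A) :=
  CStarSystem.Colim.desc_incl (S := latticeSystem Γ K) _ _ _ Λ A

/-! ### Stacking -/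

/-- A unital `*`-homomorphism `θ : B(H) → B(K)` induces `⨂_Λ θ : 𝔄_Λ(H) → 𝔄_Λ(K)`. -/
def localSiteMap (θ : (H →L[ℂ] H) →⋆ₐ[ℂ] (K →L[ℂ] K)) (Λ : Finset Γ) :
    LocAlg Λ H →⋆ₐ[ℂ] LocAlg Λ K :=
  opLiftStar (tensorOpMultilinear.compLinearMap fun _ => θ.toAlgHom.toLinearMap)
    (by
      refine Eq.trans (congrArg tensorOp ?_) tensorOp_one
      funext v
      exact map_one θ)
    (by
      intro a b
      refine Eq.trans (congrArg tensorOp ?_) (tensorOp_mul _ _).symm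
      funext v
      exact map_mul θ _ _)
    (by
      intro a
      refine Eq.trans (congrArg tensorOp ?_) (star_tensorOp _).symm
      funext v
      exact map_star θ _)

theorem localSiteMap_tensorOp (θ : (H →L[ℂ] H) →⋆ₐ[ℂ] (K →L[ℂ] K)) (Λ : Finset Γ)
    (a : Λ → (H →L[ℂ] H)) : localSiteMap θ Λ (tensorOp a) = tensorOp fun v => θ (a v) :=
  opLiftStar_tensorOp _ _ _ _ _

theorem incl_localSiteMap (θ : (H →L[ℂ] H) →⋆ₐ[ℂ] (K →L[ℂ] K)) {Λ₁ Λ₂ : Finset Γ} (h : Λ₁ ≤ Λ₂)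
    (A : LocAlg Λ₁ H) : localSiteMap θ Λ₂ (incl h A) = incl h (localSiteMap θ Λ₁ A) := by
  have : (localSiteMap θ Λ₂).toAlgHom.toLinearMap ∘ₗ (incl h).toAlgHom.toLinearMap =
      (incl h).toAlgHom.toLinearMap ∘ₗ (localSiteMap θ Λ₁).toAlgHom.toLinearMap :=
    op_linearMap_ext fun a => by
      change localSiteMap θ Λ₂ (incl h (tensorOp a)) = incl h (localSiteMap θ Λ₁ (tensorOp a))
      rw [localSiteMap_tensorOp, incl_tensorOp, incl_tensorOp, localSiteMap_tensorOp]
      congr 1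
      funext v
      by_cases hv : (v : Γ) ∈ Λ₁ <;> simp [extendOne, hv]
  exact DFunLike.congr_fun this A

variable (Γ) in
/-- The map `⨂_Γ θ : 𝔄_Γ(H) → 𝔄_Γ(K)` induced by a unital `*`-homomorphism `θ : B(H) → B(K)`. -/
def siteMap [Nontrivial H] [Nontrivial K] (θ : (H →L[ℂ] H) →⋆ₐ[ℂ] (K →L[ℂ] K)) :
    QuasiLocal Γ H →L[ℂ] QuasiLocal Γ K :=
  CStarSystem.Colim.desc (S := latticeSystem Γ H)
    (fun Λ => (localIncl Λ).toAlgHom.toLinearMap ∘ₗ (localSiteMap θ Λ).toAlgHom.toLinearMap)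
    (fun _ Λ₂ h A =>
      (congrArg (localIncl Λ₂) (incl_localSiteMap θ h A)).trans (localIncl_incl h _))
    (fun Λ A => (norm_localIncl (localSiteMap θ Λ A)).trans_le
      (NonUnitalStarAlgHom.norm_apply_le (localSiteMap θ Λ) A))

theorem siteMap_localIncl [Nontrivial H] [Nontrivial K] (θ : (H →L[ℂ] H) →⋆ₐ[ℂ] (K →L[ℂ] K))
    (Λ : Finset Γ) (A : LocAlg Λ H) :
    siteMap Γ θ (localIncl Λ A) = localIncl Λ (localSiteMap θ Λ A) :=
  CStarSystem.Colim.desc_incl (S := latticeSystem Γ H) _ _ _ Λ A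

variable (H K) in
/-- The `*`-homomorphism `B(H) → B(H ⊗ K)`, `a ↦ a ⊗ 1`. -/
def tensorLeftHom : (H →L[ℂ] H) →⋆ₐ[ℂ] (H ⊗[ℂ] K →L[ℂ] H ⊗[ℂ] K) where
  toFun a := a.rTensor K
  map_one' := ContinuousLinearMap.coe_injective (TensorProduct.ext' fun _ _ => rfl)
  map_mul' _ _ := ContinuousLinearMap.coe_injective (TensorProduct.ext' fun _ _ => rfl)
  map_zero' := ContinuousLinearMap.coe_injective
    (TensorProduct.ext' fun _ y => TensorProduct.zero_tmul _ y)
  map_add' a b := ContinuousLinearMap.coe_injective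
    (TensorProduct.ext' fun x y => TensorProduct.add_tmul (a x) (b x) y)
  commutes' _ := ContinuousLinearMap.coe_injective (TensorProduct.ext' fun _ _ => rfl)
  map_star' a := (ContinuousLinearMap.adjoint_rTensor K a).symm

variable (H K) in
/-- The `*`-homomorphism `B(K) → B(H ⊗ K)`, `b ↦ 1 ⊗ b`. -/
def tensorRightHom : (K →L[ℂ] K) →⋆ₐ[ℂ] (H ⊗[ℂ] K →L[ℂ] H ⊗[ℂ] K) where
  toFun b := b.lTensor H
  map_one' := ContinuousLinearMap.coe_injective (TensorProduct.ext' fun _ _ => rfl)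
  map_mul' _ _ := ContinuousLinearMap.coe_injective (TensorProduct.ext' fun _ _ => rfl)
  map_zero' := ContinuousLinearMap.coe_injective
    (TensorProduct.ext' fun x _ => TensorProduct.tmul_zero _ x)
  map_add' a b := ContinuousLinearMap.coe_injective
    (TensorProduct.ext' fun x y => TensorProduct.tmul_add x (a y) (b y))
  commutes' c := ContinuousLinearMap.coe_injective (TensorProduct.ext' fun x y =>
    (TensorProduct.tmul_smul c x y))
  map_star' b := (ContinuousLinearMap.adjoint_lTensor H b).symm

/-- The observable `A₁ ⊗ A₂ ∈ 𝔄_Γ(H ⊗ K)` of two observables `A₁ ∈ 𝔄_Γ(H)`, `A₂ ∈ 𝔄_Γ(K)`: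
the product of the commuting observables `A₁ ⊗ 1` and `1 ⊗ A₂`. -/
def tensorObs [Nontrivial H] [Nontrivial K] (A₁ : QuasiLocal Γ H) (A₂ : QuasiLocal Γ K) :
    QuasiLocal Γ (H ⊗[ℂ] K) :=
  siteMap Γ (tensorLeftHom H K) A₁ * siteMap Γ (tensorRightHom H K) A₂

/-- On elementary tensors: `(⨂_v a_v) ⊗ (⨂_v b_v) = ⨂_v (a_v ⊗ b_v)`. -/
theorem tensorObs_tensorOp [Nontrivial H] [Nontrivial K] (Λ : Finset Γ) (a : Λ → (H →L[ℂ] H))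
    (b : Λ → (K →L[ℂ] K)) :
    tensorObs (localIncl Λ (tensorOp a)) (localIncl Λ (tensorOp b)) =
      localIncl Λ (tensorOp fun v => TensorProduct.mapL (a v) (b v)) := by
  rw [tensorObs, siteMap_localIncl, siteMap_localIncl, localSiteMap_tensorOp,
    localSiteMap_tensorOp, ← map_mul, tensorOp_mul]
  rfl

end QuasiLocal

/-! ### Pure states -/

/-- The states of a C*-algebra: positive normalized functionals, with the weak* topology. -/
def stateSpace (A : Type u) [CStarAlgebra A] : Set (WeakDual ℂ A) :=
  {ω | (∀ a, 0 ≤ ω (star a * a)) ∧ ω 1 = 1}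

/-- The space of pure states (extreme points of the state space) with the weak* topology. -/
abbrev PureStateSpace (A : Type u) [CStarAlgebra A] : Type u :=
  (stateSpace A).extremePoints ℝ

/-- The space `𝒫_Γ(H)` of pure states of the quasi-local algebra `𝔄_Γ(H)`. -/
abbrev PureStates (Γ : Type u) (H : HilbFin) : Type u := PureStateSpace (QuasiLocal Γ H)

/-- A functor with prescribed values on objects. -/
structure FunctorOn {C : Type*} [Category* C] {D : Type*} [Category* D] (obj : C → D) where
  /-- The action on morphisms. -/
  map : ∀ {X Y : C}, (X ⟶ Y) → (obj X ⟶ obj Y)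
  map_id : ∀ X : C, map (𝟙 X) = 𝟙 (obj X)
  map_comp : ∀ {X Y Z : C} (f : X ⟶ Y) (g : Y ⟶ Z), map (f ≫ g) = map f ≫ map g

/-- The functor underlying a `FunctorOn`. -/
def FunctorOn.toFunctor {C : Type*} [Category* C] {D : Type*} [Category* D] {obj : C → D}
    (F : FunctorOn obj) : C ⥤ D where
  obj := obj
  map := F.map
  map_id := F.map_id
  map_comp := F.map_comp

end QST

end

open QST

noncomputable section

namespace QST

/-! ### Positive functionals on C*-algebras -/

section PositiveFunctional

variable {A : Type*} [CStarAlgebra A]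

/-! Write `p_Λ = f_Λ f_Λ^*` (in the code `corner f Λ 1`). The map `𝔄_Γ(f)` is unital and positive,
being locally the compression by an isometry, so `ω ↦ ω ∘ 𝔄_Γ(f)` sends states to states. Its image
consists of the states φ with `φ(p_Λ) = 1` for every finite Λ. By Cauchy-Schwarz such a φ does not
change under compression by `p_Λ` (`map_compress`), so it is determined by the local functionals `A
↦ φ(f_Λ A f_Λ^*)`, and these glue to a state of `𝔄_Γ(H)`. The support condition is weak* closed. It
also passes to the components of a convex decomposition, since a state takes values at most 1 on
projections. Hence the image is a closed face. Pure states therefore go to pure states, and the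
local formula for the inverse shows that the map is a closed embedding.

Products of states are built locally. A positive functional gives positive semidefinite Gram
matrices, and the Schur product theorem makes the product functional positive
(`sum_map_mul_map_nonneg`). Compatible local states extend to the colimit. Purity of `ω₁ ⊗ ω₂` rests
on the rigidity statement `map_mul_of_pure`: if a state restricts to a pure state on a subalgebra,
it factorizes against everything that commutes with that subalgebra. A component of a decomposition
of `ω₁ ⊗ ω₂` has the pure marginals `ω₁` and `ω₂`, so it factorizes and equals `ω₁ ⊗ ω₂`.
Naturality, associativity and unitality are then identities of scalars on elementary tensors, which
determine a functional.

On the topological side, states are contractions, so weak* continuity can be tested on a norm-dense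
set. For countable Γ the quasi-local algebra is separable, hence pure state spaces are first
countable and Hausdorff, in particular compactly generated. The joint continuity of `(f, ω) ↦ ω ∘
𝔄_Γ(f)` also reduces to local observables, where `f_Λ^* A f_Λ` is norm continuous in f. Since spaces
of isometries are compact, currying gives continuity into the k-ified mapping space. -/

/-- In a unital C*-algebra, `r ^ 2 - a^* a` is again of the form `c^* c` if `‖a‖ ≤ r`. -/
theorem exists_sq_sub_eq_star_mul_self {a : A} {r : ℝ} (hr : ‖a‖ ≤ r) :
    ∃ c : A, ((r ^ 2 : ℝ) : ℂ) • (1 : A) - star a * a = star c * c := by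
  let := CStarAlgebra.spectralOrder A
  let := CStarAlgebra.spectralOrderedRing A
  have h : 0 ≤ ((r ^ 2 : ℝ) : ℂ) • (1 : A) - star a * a := by
    rw [sub_nonneg, Complex.coe_smul, ← Algebra.algebraMap_eq_smul_one]
    refine (IsSelfAdjoint.le_algebraMap_norm_self (.star_mul_self a)).trans ?_
    rw [CStarRing.norm_star_mul_self, ← sq]
    exact algebraMap_mono A (pow_le_pow_left₀ (norm_nonneg a) hr 2)
  exact CStarAlgebra.nonneg_iff_eq_star_mul_self.1 h

/-- Every element of a unital C*-algebra is a linear combination of elements `c^* c` with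
`‖c‖ ≤ 1`. -/
theorem span_star_mul_self_eq_top :
    Submodule.span ℂ {b : A | ∃ c : A, ‖c‖ ≤ 1 ∧ b = star c * c} = ⊤ := by
  let := CStarAlgebra.spectralOrder A
  let := CStarAlgebra.spectralOrderedRing A
  refine eq_top_iff.2 fun x _ => ?_
  obtain ⟨y, hy, -, rfl⟩ := CStarAlgebra.exists_sum_four_nonneg x
  refine Submodule.sum_mem _ fun i _ => Submodule.smul_mem _ _ ?_
  obtain ⟨c, hc⟩ := CStarAlgebra.nonneg_iff_eq_star_mul_self.1 (hy i)
  rw [hc]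
  rcases eq_or_ne c 0 with rfl | h0
  · simp
  have hn : (‖c‖ : ℂ) ≠ 0 := by simpa using h0
  -- Rescaling to norm one: the bound on the norm is what makes `1 - c^* c` a square again in
  -- `map_mul_of_pure`.
  have : star c * c = ((‖c‖ : ℂ) * ‖c‖) • (star ((‖c‖ : ℂ)⁻¹ • c) * ((‖c‖ : ℂ)⁻¹ • c)) := by
    rw [star_smul, smul_mul_smul_comm, smul_smul]
    simp
    field_simp
    simp
  rw [this]
  refine Submodule.smul_mem _ _ (Submodule.subset_span ⟨_, ?_, rfl⟩)
  rw [norm_smul]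
  simp [h0]

/-- A functional which is nonnegative on the elements `a^* a`, as a positive linear map for the
spectral order. -/
theorem exists_positiveLinearMap {ω : A →ₗ[ℂ] ℂ} (hω : ∀ a, 0 ≤ ω (star a * a)) :
    letI := CStarAlgebra.spectralOrder A
    ∃ f : A →ₚ[ℂ] ℂ, ∀ a, f a = ω a := by
  let := CStarAlgebra.spectralOrder A
  let := CStarAlgebra.spectralOrderedRing A
  exact ⟨.mk₀ ω fun x hx => by
    obtain ⟨c, rfl⟩ := CStarAlgebra.nonneg_iff_eq_star_mul_self.1 hx
    exact hω c, fun _ => rfl⟩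

theorem map_star_of_positive {ω : A →ₗ[ℂ] ℂ} (hω : ∀ a, 0 ≤ ω (star a * a)) (a : A) :
    ω (star a) = star (ω a) := by
  let := CStarAlgebra.spectralOrder A
  let := CStarAlgebra.spectralOrderedRing A
  obtain ⟨f, hf⟩ := exists_positiveLinearMap hω
  rw [← hf, ← hf, map_star]

/-- The Cauchy-Schwarz inequality for positive functionals. -/
theorem norm_map_star_mul_sq_le {ω : A →ₗ[ℂ] ℂ} (hω : ∀ a, 0 ≤ ω (star a * a)) (a b : A) :
    ‖ω (star a * b)‖ ^ 2 ≤ (ω (star a * a)).re * (ω (star b * b)).re := by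
  let := CStarAlgebra.spectralOrder A
  let := CStarAlgebra.spectralOrderedRing A
  obtain ⟨f, hf⟩ := exists_positiveLinearMap hω
  -- In the pre-GNS space the inner product of a and b is `ω(a^* b)`, so this is the Cauchy-Schwarz
  -- inequality there.
  have h := norm_inner_le_norm (𝕜 := ℂ) (f.toPreGNS a) (f.toPreGNS b)
  have ha := congrArg Complex.re (f.preGNS_norm_sq (f.toPreGNS a))
  have hb := congrArg Complex.re (f.preGNS_norm_sq (f.toPreGNS b))
  rw [f.preGNS_inner_def] at h
  simp only [f.ofPreGNS_toPreGNS, hf] at h ha hb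
  rw [← ha, ← hb, ← Complex.ofReal_pow, ← Complex.ofReal_pow, Complex.ofReal_re,
    Complex.ofReal_re, ← mul_pow]
  exact pow_le_pow_left₀ (norm_nonneg _) h 2

theorem map_one_nonneg {ω : A →ₗ[ℂ] ℂ} (hω : ∀ a, 0 ≤ ω (star a * a)) : 0 ≤ ω 1 := by
  simpa using hω 1

/-- A positive functional has norm `ω 1`. -/
theorem norm_map_le_of_positive {ω : A →ₗ[ℂ] ℂ} (hω : ∀ a, 0 ≤ ω (star a * a)) (a : A) :
    ‖ω a‖ ≤ (ω 1).re * ‖a‖ := by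
  -- Cauchy-Schwarz against the unit gives `|ω(a)|² ≤ ω(1) ω(a^* a)`; positivity of ω on `‖a‖² - a^*
  -- a` bounds the last factor by `‖a‖² ω(1)`.
  have h1 := norm_map_star_mul_sq_le hω 1 a
  obtain ⟨c, hc⟩ := exists_sq_sub_eq_star_mul_self (le_refl ‖a‖)
  have h2 := (Complex.le_def.1 (hω c)).1
  have h0 := (Complex.le_def.1 (map_one_nonneg hω)).1
  rw [← hc, map_sub, map_smul, smul_eq_mul, Complex.sub_re, Complex.re_ofReal_mul] at h2
  simp only [star_one, one_mul, Complex.zero_re] at h1 h2 h0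
  refine le_of_sq_le_sq (h1.trans ?_) (by positivity)
  rw [mul_pow, sq (ω 1).re, mul_assoc]
  refine mul_le_mul_of_nonneg_left ?_ h0
  linarith

/-- Null vectors of the semi-inner product `ω(a^* b)` are orthogonal to everything, by
Cauchy-Schwarz. -/
theorem map_star_mul_eq_zero {ω : A →ₗ[ℂ] ℂ} (hω : ∀ a, 0 ≤ ω (star a * a)) {a : A}
    (ha : ω (star a * a) = 0) (b : A) : ω (star a * b) = 0 := by
  have h := norm_map_star_mul_sq_le hω a b
  rw [ha, Complex.zero_re, zero_mul] at h
  exact norm_eq_zero.1 (pow_eq_zero_iff two_ne_zero |>.1 (le_antisymm h (sq_nonneg _)))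

theorem map_mul_eq_zero {ω : A →ₗ[ℂ] ℂ} (hω : ∀ a, 0 ≤ ω (star a * a)) {a : A}
    (ha : ω (star a * a) = 0) (b : A) : ω (b * a) = 0 := by
  have h := norm_map_star_mul_sq_le hω (star b) a
  rw [ha, Complex.zero_re, mul_zero, star_star] at h
  exact norm_eq_zero.1 (pow_eq_zero_iff two_ne_zero |>.1 (le_antisymm h (sq_nonneg _)))

/-- A positive functional is determined by its values on a corner of full mass. -/
theorem map_compress {ω : A →ₗ[ℂ] ℂ} (hω : ∀ a, 0 ≤ ω (star a * a)) {e : A}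
    (hs : star e = e) (he : e * e = e) (h1 : ω e = ω 1) (a : A) : ω (e * a * e) = ω a := by
  -- The complementary projection `1 - e` is a null vector, so ω kills `(1 - e) a e` and `a (1 -
  -- e)`; thus `ω(e a e) = ω(a e) = ω(a)`.
  have h0 : ω (star (1 - e) * (1 - e)) = 0 := by
    have : star (1 - e) * (1 - e) = 1 - e := by
      rw [star_sub, star_one, hs, mul_sub, sub_mul, sub_mul, he]
      simp
    rw [this, map_sub, h1, sub_self]
  have h2 := map_star_mul_eq_zero hω h0 (a * e)
  have h3 := map_mul_eq_zero hω h0 a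
  rw [star_sub, star_one, hs, sub_mul, one_mul, map_sub, sub_eq_zero] at h2
  rw [mul_sub, mul_one, map_sub, sub_eq_zero] at h3
  rw [mul_assoc, ← h2, ← h3]

/-- A positive functional as an element of the weak dual. -/
def positiveWeakDual (ω : A →ₗ[ℂ] ℂ) (hω : ∀ a, 0 ≤ ω (star a * a)) : WeakDual ℂ A :=
  StrongDual.toWeakDual (ω.mkContinuous (ω 1).re (norm_map_le_of_positive hω))

end PositiveFunctional

/-! ### States -/

section State

variable {A : Type u} [CStarAlgebra A]

/-- The linear functional underlying an element of the weak dual. -/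
def linearOfWeakDual (ω : WeakDual ℂ A) : A →ₗ[ℂ] ℂ := (WeakDual.toStrongDual ω).toLinearMap

theorem linearOfWeakDual_apply (ω : WeakDual ℂ A) (a : A) : linearOfWeakDual ω a = ω a := rfl

theorem positiveWeakDual_mem_stateSpace (ω : A →ₗ[ℂ] ℂ) (hω : ∀ a, 0 ≤ ω (star a * a))
    (h1 : ω 1 = 1) : positiveWeakDual ω hω ∈ stateSpace A := ⟨hω, h1⟩

theorem norm_state_le {ω : WeakDual ℂ A} (hω : ω ∈ stateSpace A) (a : A) : ‖ω a‖ ≤ ‖a‖ := by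
  have h := norm_map_le_of_positive (ω := linearOfWeakDual ω) hω.1 a
  rwa [linearOfWeakDual_apply, linearOfWeakDual_apply, hω.2, Complex.one_re, one_mul] at h

theorem continuous_eval_weakDual (a : A) : Continuous fun ω : WeakDual ℂ A => ω a :=
  WeakDual.eval_continuous a

/-- A family of states is weak* continuous if it is continuous on a dense set of observables. -/
theorem continuous_of_dense_eval {X : Type*} [TopologicalSpace X] {D : Set A} (hD : Dense D)
    {g : X → WeakDual ℂ A} (hg : ∀ x, g x ∈ stateSpace A)
    (h : ∀ a ∈ D, Continuous fun x => g x a) : Continuous g := by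
  refine WeakDual.continuous_of_continuous_eval fun a => ?_
  -- States are contractions, so replacing a by a nearby b in D changes the evaluation by less than
  -- ε uniformly over the whole family.
  refine continuous_of_uniform_approx_of_continuous fun s hs => ?_
  obtain ⟨ε, hε, hεs⟩ := Metric.mem_uniformity_dist.1 hs
  obtain ⟨b, hb, hab⟩ := hD.exists_dist_lt a hε
  refine ⟨fun x => g x b, h b hb, fun x => hεs ?_⟩
  rw [dist_eq_norm, ← map_sub]
  exact (norm_state_le (hg x) _).trans_lt (by rwa [← dist_eq_norm])

theorem state_ext_of_dense {D : Set A} (hD : Dense D) {ω ω' : WeakDual ℂ A}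
    (h : ∀ a ∈ D, ω a = ω' a) : ω = ω' :=
  DFunLike.coe_injective (Continuous.ext_on hD (WeakDual.toStrongDual ω).continuous
    (WeakDual.toStrongDual ω').continuous h)

/-- The functionals `ψ₁`, `ψ₂` in a decomposition `ω = ψ₁ + ψ₂` of a pure state are multiples of
`ω`. -/
theorem eq_mul_of_pure {ω : WeakDual ℂ A} (hω : ω ∈ (stateSpace A).extremePoints ℝ)
    {ψ₁ ψ₂ : A →ₗ[ℂ] ℂ} (h₁ : ∀ a, 0 ≤ ψ₁ (star a * a)) (h₂ : ∀ a, 0 ≤ ψ₂ (star a * a))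
    (h : ∀ a, ω a = ψ₁ a + ψ₂ a) (a : A) : ψ₁ a = ψ₁ 1 * ω a := by
  have hs := h 1
  rw [hω.1.2] at hs
  obtain ⟨t, ht⟩ : ∃ t : ℝ, ψ₁ 1 = t :=
    ⟨(ψ₁ 1).re, (Complex.eq_re_of_ofReal_le (r := 0) (by simpa using h₁ 1))⟩
  have hs2 : ψ₂ 1 = ((1 - t : ℝ) : ℂ) := by
    rw [Complex.ofReal_sub, ← ht]
    exact eq_sub_of_add_eq' hs.symm
  have ht0 : 0 ≤ t := by
    have := map_one_nonneg h₁
    rw [ht] at this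
    exact_mod_cast this
  have ht1 : 0 ≤ 1 - t := by
    have := map_one_nonneg h₂
    rw [hs2] at this
    exact_mod_cast this
  -- In the boundary cases `t = 0` and `t = 1` the norm bound `‖ψ a‖ ≤ ψ(1) ‖a‖` makes one summand
  -- vanish. Otherwise both summands are rescaled to states and extremality applies.
  rcases ht0.eq_or_lt with rfl | ht0
  · have := norm_map_le_of_positive h₁ a
    rw [ht, Complex.ofReal_re, zero_mul] at this
    rw [norm_le_zero_iff.1 this, ht]
    simp
  rcases ht1.eq_or_lt with ht1 | ht1
  · have := norm_map_le_of_positive h₂ a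
    rw [hs2, Complex.ofReal_re, ← ht1, zero_mul] at this
    rw [h a, norm_le_zero_iff.1 this, ht, show t = 1 by linarith]
    simp
  have pos : ∀ {ψ : A →ₗ[ℂ] ℂ} (_ : ∀ a, 0 ≤ ψ (star a * a)) {s : ℝ} (_ : 0 < s) (a : A),
      0 ≤ ((s⁻¹ : ℝ) • ψ) (star a * a) := fun hψ s hs a => by
    rw [LinearMap.smul_apply]
    exact smul_nonneg (inv_pos.2 hs).le (hψ a)
  have one : ∀ {ψ : A →ₗ[ℂ] ℂ} {s : ℝ} (_ : 0 < s) (_ : ψ 1 = s), ((s⁻¹ : ℝ) • ψ) 1 = 1 :=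
    fun hs h => by
      rw [LinearMap.smul_apply, h, Complex.real_smul, ← Complex.ofReal_mul, inv_mul_cancel₀ hs.ne',
        Complex.ofReal_one]
  have key := hω.2 (positiveWeakDual_mem_stateSpace _ (pos h₁ ht0) (one ht0 ht))
    (positiveWeakDual_mem_stateSpace _ (pos h₂ ht1) (one ht1 hs2))
    ⟨t, 1 - t, ht0, ht1, by ring, by
      refine DFunLike.ext _ _ fun b => ?_
      rw [h b]
      change t • (t⁻¹ • ψ₁ b) + (1 - t) • ((1 - t)⁻¹ • ψ₂ b) = _
      rw [smul_smul, smul_smul, mul_inv_cancel₀ ht0.ne', mul_inv_cancel₀ ht1.ne', one_smul,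
        one_smul]⟩
  have key2 : t⁻¹ • ψ₁ a = ω a := DFunLike.congr_fun key a
  rw [← key2, ht, Complex.real_smul, ← mul_assoc, ← Complex.ofReal_mul, mul_inv_cancel₀ ht0.ne']
  simp

/-- A state whose restriction to a subalgebra is pure is multiplicative with respect to observables
commuting with this subalgebra. -/
theorem map_mul_of_pure {B : Type v} [CStarAlgebra B] {C : Type w} [CStarAlgebra C]
    (π : B →⋆ₐ[ℂ] A) (ρ : C →⋆ₐ[ℂ] A) (hc : ∀ b c, Commute (π b) (ρ c))
    {φ : WeakDual ℂ A} (hφ : φ ∈ stateSpace A) {ω : WeakDual ℂ B}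
    (hω : ω ∈ (stateSpace B).extremePoints ℝ) (h : ∀ b, φ (π b) = ω b) (b : B) (c : C) :
    φ (π b * ρ c) = ω b * φ (ρ c) := by
  have hmem : c ∈ Submodule.span ℂ {b : C | ∃ c : C, ‖c‖ ≤ 1 ∧ b = star c * c} := by
    rw [span_star_mul_self_eq_top]
    trivial
  induction hmem using Submodule.span_induction with
  | zero => simp
  | add x y _ _ hx hy => rw [map_add, mul_add, map_add, map_add, hx, hy, mul_add]
  | smul r x _ hx => rw [map_smul, mul_smul_comm, map_smul, map_smul, hx, smul_eq_mul, smul_eq_mul,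
      mul_left_comm]
  | mem x hx =>
    obtain ⟨d, hd, rfl⟩ := hx
    obtain ⟨e, he⟩ := exists_sq_sub_eq_star_mul_self hd
    rw [one_pow, Complex.ofReal_one, one_smul] at he
    -- As `d^* d + e^* e = 1`, the functionals `ψ d` and `ψ e` add up to the pure state ω. Both are
    -- positive because commutation turns `π(b^* b) ρ(z^* z)` into the square of `π(b) ρ(z)`. Hence
    -- `ψ d` is a multiple of ω.
    let ψ : C → B →ₗ[ℂ] ℂ := fun z =>
      linearOfWeakDual φ ∘ₗ LinearMap.mulRight ℂ (ρ (star z * z)) ∘ₗ π.toAlgHom.toLinearMap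
    have hψ : ∀ z b, ψ z b = φ (π b * ρ (star z * z)) := fun _ _ => rfl
    have hpos : ∀ z b, 0 ≤ ψ z (star b * b) := fun z b => by
      have : π (star b * b) * ρ (star z * z) = star (π b * ρ z) * (π b * ρ z) := by
        rw [map_mul, map_mul, map_star, map_star, star_mul, mul_assoc, mul_assoc,
          ← mul_assoc (π b), ← map_star ρ, (hc b (star z)).eq, mul_assoc, ← mul_assoc (star (π b)),
          ← map_star π, (hc (star b) (star z)).eq, mul_assoc]
      rw [hψ, this]
      exact hφ.1 _
    have := eq_mul_of_pure hω (hpos d) (hpos e) (fun b => by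
      rw [hψ, hψ, ← h, ← map_add, ← mul_add, ← map_add, ← he, add_sub_cancel, map_one, mul_one]) b
    rw [hψ, hψ, map_one, one_mul] at this
    rw [this, mul_comm]

end State

/-! ### States of the quasi-local algebra -/

section QuasiLocalState

variable {Γ : Type u} {H : Type v} [NormedAddCommGroup H] [InnerProductSpace ℂ H]
  [FiniteDimensional ℂ H] [Nontrivial H]

theorem QuasiLocal.induction {p : QuasiLocal Γ H → Prop} (hp : IsClosed {x | p x})
    (h : ∀ (Λ : Finset Γ) (A : LocAlg Λ H), p (localIncl Λ A)) (x : QuasiLocal Γ H) : p x :=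
  CStarSystem.Colim.induction hp (CStarSystem.Union.induction h) x

variable (Γ H) in
/-- The set of local observables. -/
def localObs : Set (QuasiLocal Γ H) := ⋃ Λ : Finset Γ, Set.range (localIncl (H := H) Λ)

theorem localIncl_mem_localObs (Λ : Finset Γ) (A : LocAlg Λ H) : localIncl Λ A ∈ localObs Γ H :=
  Set.mem_iUnion.2 ⟨Λ, A, rfl⟩

theorem dense_localObs : Dense (localObs Γ H) := fun x =>
  QuasiLocal.induction (p := fun x => x ∈ closure (localObs Γ H)) isClosed_closure
    (fun Λ A => subset_closure (localIncl_mem_localObs Λ A)) x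

/-- Countability of Γ enters here: there are countably many finite regions, each contributes a
finite-dimensional, hence separable, algebra, and their union is dense. -/
instance [Countable Γ] : SeparableSpace (QuasiLocal Γ H) := by
  have : IsSeparable (localObs Γ H) := .iUnion fun Λ => by
    have hc : Continuous (localIncl (H := H) Λ) :=
      AddMonoidHomClass.continuous_of_bound (localIncl (H := H) Λ) 1 fun A => by
        rw [norm_localIncl, one_mul]
    have : ProperSpace (LocAlg Λ H) := FiniteDimensional.proper ℂ _
    exact isSeparable_range hc
  have h := this.closure
  rw [dense_localObs.closure_eq] at h
  exact isSeparable_univ_iff.1 h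

theorem weakDual_ext_local {ω ω' : WeakDual ℂ (QuasiLocal Γ H)}
    (h : ∀ (Λ : Finset Γ) (a : Λ → (H →L[ℂ] H)),
      ω (localIncl Λ (tensorOp a)) = ω' (localIncl Λ (tensorOp a))) : ω = ω' := by
  refine state_ext_of_dense dense_localObs fun x hx => ?_
  obtain ⟨Λ, A, rfl⟩ := Set.mem_iUnion.1 hx
  have : linearOfWeakDual ω ∘ₗ (localIncl Λ).toAlgHom.toLinearMap =
      linearOfWeakDual ω' ∘ₗ (localIncl Λ).toAlgHom.toLinearMap := op_linearMap_ext (h Λ)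
  exact DFunLike.congr_fun this A

theorem continuous_of_local_eval {X : Type*} [TopologicalSpace X]
    {g : X → WeakDual ℂ (QuasiLocal Γ H)} (hg : ∀ x, g x ∈ stateSpace (QuasiLocal Γ H))
    (h : ∀ (Λ : Finset Γ) (A : LocAlg Λ H), Continuous fun x => g x (localIncl Λ A)) :
    Continuous g :=
  continuous_of_dense_eval dense_localObs hg fun x hx => by
    obtain ⟨Λ, A, rfl⟩ := Set.mem_iUnion.1 hx
    exact h Λ A

theorem norm_local_le {Λ : Finset Γ} {φ : LocAlg Λ H →ₗ[ℂ] ℂ} (hpos : ∀ A, 0 ≤ φ (star A * A))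
    (hone : φ 1 = 1) (A : LocAlg Λ H) : ‖φ A‖ ≤ ‖A‖ := by
  have h := norm_map_le_of_positive hpos A
  rwa [hone, Complex.one_re, one_mul] at h

/-- The functional on the quasi-local algebra with prescribed (positive and normalized)
restrictions to the local algebras. -/
def stateOfLocal (φ : ∀ Λ : Finset Γ, LocAlg Λ H →ₗ[ℂ] ℂ)
    (hφ : ∀ ⦃Λ₁ Λ₂ : Finset Γ⦄ (h : Λ₁ ≤ Λ₂) A, φ Λ₂ (incl h A) = φ Λ₁ A)
    (hpos : ∀ Λ A, 0 ≤ φ Λ (star A * A)) (hone : ∀ Λ, φ Λ 1 = 1) :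
    WeakDual ℂ (QuasiLocal Γ H) :=
  StrongDual.toWeakDual (CStarSystem.Colim.desc (S := latticeSystem Γ H) φ hφ fun Λ =>
    norm_local_le (hpos Λ) (hone Λ))

theorem stateOfLocal_localIncl (φ : ∀ Λ : Finset Γ, LocAlg Λ H →ₗ[ℂ] ℂ)
    (hφ : ∀ ⦃Λ₁ Λ₂ : Finset Γ⦄ (h : Λ₁ ≤ Λ₂) A, φ Λ₂ (incl h A) = φ Λ₁ A)
    (hpos : ∀ Λ A, 0 ≤ φ Λ (star A * A)) (hone : ∀ Λ, φ Λ 1 = 1) (Λ : Finset Γ)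
    (A : LocAlg Λ H) : stateOfLocal φ hφ hpos hone (localIncl Λ A) = φ Λ A :=
  CStarSystem.Colim.desc_incl (S := latticeSystem Γ H) φ hφ
    (fun Λ => norm_local_le (hpos Λ) (hone Λ)) Λ A

/-- Positivity on squares is a norm-closed condition on the observable, so the dense local algebras
suffice. -/
theorem mem_stateSpace_of_local {ω : WeakDual ℂ (QuasiLocal Γ H)}
    (hpos : ∀ (Λ : Finset Γ) (A : LocAlg Λ H), 0 ≤ ω (localIncl Λ (star A * A)))
    (hone : ω 1 = 1) : ω ∈ stateSpace (QuasiLocal Γ H) := by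
  refine ⟨QuasiLocal.induction ?_ fun Λ A => ?_, hone⟩
  · exact isClosed_le continuous_const
      ((WeakDual.toStrongDual ω).continuous.comp (continuous_star.mul continuous_id))
  · rw [← map_star, ← map_mul]
    exact hpos Λ A

theorem stateOfLocal_mem_stateSpace (φ : ∀ Λ : Finset Γ, LocAlg Λ H →ₗ[ℂ] ℂ)
    (hφ : ∀ ⦃Λ₁ Λ₂ : Finset Γ⦄ (h : Λ₁ ≤ Λ₂) A, φ Λ₂ (incl h A) = φ Λ₁ A)
    (hpos : ∀ Λ A, 0 ≤ φ Λ (star A * A)) (hone : ∀ Λ, φ Λ 1 = 1) :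
    stateOfLocal φ hφ hpos hone ∈ stateSpace (QuasiLocal Γ H) :=
  mem_stateSpace_of_local
    (fun Λ A => (hpos Λ A).trans_eq (stateOfLocal_localIncl φ hφ hpos hone Λ _).symm)
    (by rw [← map_one (localIncl (H := H) (∅ : Finset Γ)), stateOfLocal_localIncl, hone])

end QuasiLocalState

/-! ### Pure states and isometries -/

section Pullback

variable {Γ : Type u} {H K L : Type v} [NormedAddCommGroup H] [InnerProductSpace ℂ H]
  [FiniteDimensional ℂ H] [NormedAddCommGroup K] [InnerProductSpace ℂ K] [FiniteDimensional ℂ K]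
  [NormedAddCommGroup L] [InnerProductSpace ℂ L] [FiniteDimensional ℂ L]

/-- For T between different spaces, `T^* T` is a positive operator on V and so has a square root
there. This brings it to the form `C^* C` inside one algebra, on which positivity of a state is
defined. -/
theorem exists_adjoint_comp_self_eq {V W : Type*} [NormedAddCommGroup V] [InnerProductSpace ℂ V]
    [CompleteSpace V] [NormedAddCommGroup W] [InnerProductSpace ℂ W] [CompleteSpace W]
    (T : V →L[ℂ] W) : ∃ C : V →L[ℂ] V, T.adjoint ∘L T = star C * C := by
  have h : 0 ≤ T.adjoint ∘L T := by
    rw [ContinuousLinearMap.nonneg_iff_isPositive]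
    exact ContinuousLinearMap.isPositive_adjoint_comp_self _
  exact CStarAlgebra.nonneg_iff_eq_star_mul_self.1 h

/-- Compression is not multiplicative, but `f_Λ^* A^* A f_Λ = (A f_Λ)^* (A f_Λ)` is still positive.
-/
theorem adIso_star_mul_self (f : H →ₗᵢ[ℂ] K) (Λ : Finset Γ) (A : LocAlg Λ K) :
    ∃ C : LocAlg Λ H, adIso f Λ (star A * A) = star C * C := by
  have h : adIso f Λ (star A * A) = (A ∘L isoPow f Λ).adjoint ∘L (A ∘L isoPow f Λ) := by
    rw [ContinuousLinearMap.adjoint_comp]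
    rfl
  rw [h]
  exact exists_adjoint_comp_self_eq _

theorem adIso_one (f : H →ₗᵢ[ℂ] K) (Λ : Finset Γ) : adIso f Λ 1 = 1 :=
  isoPow_adjoint_comp f Λ

/-- The map `𝔄_Λ(H) → 𝔄_Λ(K)`, `A ↦ f_Λ A f_Λ^*`. -/
def corner (f : H →ₗᵢ[ℂ] K) (Λ : Finset Γ) : LocAlg Λ H →ₗ[ℂ] LocAlg Λ K where
  toFun A := isoPow f Λ ∘L A ∘L (isoPow f Λ).adjoint
  map_add' A B := by
    ext x
    simp
  map_smul' c A := by
    ext x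
    simp

theorem corner_apply (f : H →ₗᵢ[ℂ] K) (Λ : Finset Γ) (A : LocAlg Λ H) :
    corner f Λ A = isoPow f Λ ∘L A ∘L (isoPow f Λ).adjoint := rfl

theorem isoPow_adjoint_apply (f : H →ₗᵢ[ℂ] K) (Λ : Finset Γ) (x : TPow Λ H) :
    (isoPow f Λ).adjoint (isoPow f Λ x) = x :=
  DFunLike.congr_fun (isoPow_adjoint_comp f Λ) x

theorem adIso_corner (f : H →ₗᵢ[ℂ] K) (Λ : Finset Γ) (A : LocAlg Λ H) :
    adIso f Λ (corner f Λ A) = A := by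
  ext1 x
  change (isoPow f Λ).adjoint (isoPow f Λ (A ((isoPow f Λ).adjoint (isoPow f Λ x)))) = A x
  rw [isoPow_adjoint_apply, isoPow_adjoint_apply]

theorem corner_mul (f : H →ₗᵢ[ℂ] K) (Λ : Finset Γ) (A B : LocAlg Λ H) :
    corner f Λ (A * B) = corner f Λ A * corner f Λ B := by
  ext1 x
  change isoPow f Λ (A (B _)) = isoPow f Λ (A ((isoPow f Λ).adjoint (isoPow f Λ (B _))))
  rw [isoPow_adjoint_apply]

theorem corner_star (f : H →ₗᵢ[ℂ] K) (Λ : Finset Γ) (A : LocAlg Λ H) :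
    corner f Λ (star A) = star (corner f Λ A) := by
  rw [ContinuousLinearMap.star_eq_adjoint, ContinuousLinearMap.star_eq_adjoint, corner_apply,
    corner_apply, ContinuousLinearMap.adjoint_comp, ContinuousLinearMap.adjoint_comp,
    ContinuousLinearMap.adjoint_adjoint, ContinuousLinearMap.comp_assoc]

/-- In this order the composite is compression by the projection `f_Λ f_Λ^*`. It is invisible only
to functionals giving this projection full mass. -/
theorem corner_adIso (f : H →ₗᵢ[ℂ] K) (Λ : Finset Γ) (A : LocAlg Λ K) :
    corner f Λ (adIso f Λ A) = corner f Λ 1 * A * corner f Λ 1 := rfl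

variable [Nontrivial H] [Nontrivial K] [Nontrivial L]

/-- A state of `𝔄_Γ(K)` is supported on the range of `f` if all the projections `f_Λ f_Λ^*` have
expectation one. -/
def IsSupportedOn (f : H →ₗᵢ[ℂ] K) (φ : WeakDual ℂ (QuasiLocal Γ K)) : Prop :=
  ∀ Λ : Finset Γ, φ (localIncl Λ (corner f Λ 1)) = 1

theorem IsSupportedOn.map_corner_adIso {f : H →ₗᵢ[ℂ] K} {φ : WeakDual ℂ (QuasiLocal Γ K)}
    (hφ : φ ∈ stateSpace (QuasiLocal Γ K)) (h : IsSupportedOn f φ) (Λ : Finset Γ)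
    (A : LocAlg Λ K) : φ (localIncl Λ (corner f Λ (adIso f Λ A))) = φ (localIncl Λ A) := by
  have key := map_compress (ω := linearOfWeakDual φ) hφ.1 (e := localIncl Λ (corner f Λ 1))
    (by rw [← map_star, ← corner_star, star_one]) (by rw [← map_mul, ← corner_mul, one_mul])
    ((h Λ).trans hφ.2.symm) (localIncl Λ A)
  rwa [← map_mul, ← map_mul, ← corner_adIso] at key

/-- The functional `ω ∘ 𝔄_Γ(f)`. -/
def pullback (f : H →ₗᵢ[ℂ] K) (ω : WeakDual ℂ (QuasiLocal Γ H)) : WeakDual ℂ (QuasiLocal Γ K) :=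
  StrongDual.toWeakDual ((WeakDual.toStrongDual ω).comp (quasiLocalMap Γ f))

theorem pullback_apply (f : H →ₗᵢ[ℂ] K) (ω : WeakDual ℂ (QuasiLocal Γ H)) (A : QuasiLocal Γ K) :
    pullback f ω A = ω (quasiLocalMap Γ f A) := rfl

theorem pullback_localIncl (f : H →ₗᵢ[ℂ] K) (ω : WeakDual ℂ (QuasiLocal Γ H)) (Λ : Finset Γ)
    (A : LocAlg Λ K) : pullback f ω (localIncl Λ A) = ω (localIncl Λ (adIso f Λ A)) := by
  rw [pullback_apply, quasiLocalMap_localIncl]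

theorem pullback_mem_stateSpace (f : H →ₗᵢ[ℂ] K) {ω : WeakDual ℂ (QuasiLocal Γ H)}
    (hω : ω ∈ stateSpace (QuasiLocal Γ H)) : pullback f ω ∈ stateSpace (QuasiLocal Γ K) := by
  refine mem_stateSpace_of_local (fun Λ A => ?_) ?_
  · obtain ⟨C, hC⟩ := adIso_star_mul_self f Λ A
    rw [pullback_localIncl, hC, map_mul, map_star]
    exact hω.1 _
  · rw [← map_one (localIncl (H := K) (∅ : Finset Γ)), pullback_localIncl, adIso_one, map_one]
    exact hω.2

theorem isSupportedOn_pullback (f : H →ₗᵢ[ℂ] K) {ω : WeakDual ℂ (QuasiLocal Γ H)}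
    (hω : ω ∈ stateSpace (QuasiLocal Γ H)) : IsSupportedOn f (pullback f ω) := fun Λ => by
  rw [pullback_localIncl, adIso_corner, map_one]
  exact hω.2

/-- This local inverse formula yields both injectivity of the pullback and continuity of its inverse
on the image. -/
theorem apply_localIncl_eq_pullback (f : H →ₗᵢ[ℂ] K) (ω : WeakDual ℂ (QuasiLocal Γ H))
    (Λ : Finset Γ) (A : LocAlg Λ H) :
    ω (localIncl Λ A) = pullback f ω (localIncl Λ (corner f Λ A)) := by
  rw [pullback_localIncl, adIso_corner]

theorem pullback_injective (f : H →ₗᵢ[ℂ] K) :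
    Function.Injective (pullback (Γ := Γ) f) := fun ω ω' h => weakDual_ext_local fun Λ a => by
  rw [apply_localIncl_eq_pullback f, h, ← apply_localIncl_eq_pullback]

/-- The preimage is `A ↦ φ(f_Λ A f_Λ^*)` on each region. The maps `corner f Λ` need not commute with
the inclusions, because `f f^*` need not be 1, but a supported φ does not detect the difference. -/
theorem IsSupportedOn.exists_pullback_eq {f : H →ₗᵢ[ℂ] K} {φ : WeakDual ℂ (QuasiLocal Γ K)}
    (hφ : φ ∈ stateSpace (QuasiLocal Γ K)) (h : IsSupportedOn f φ) :
    ∃ ψ ∈ stateSpace (QuasiLocal Γ H), pullback f ψ = φ := by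
  let ψ : ∀ Λ : Finset Γ, LocAlg Λ H →ₗ[ℂ] ℂ := fun Λ =>
    linearOfWeakDual φ ∘ₗ (localIncl Λ).toAlgHom.toLinearMap ∘ₗ corner f Λ
  have hψ : ∀ Λ A, ψ Λ A = φ (localIncl Λ (corner f Λ A)) := fun _ _ => rfl
  have h1 : ∀ ⦃Λ₁ Λ₂ : Finset Γ⦄ (h : Λ₁ ≤ Λ₂) A, ψ Λ₂ (incl h A) = ψ Λ₁ A := by
    intro Λ₁ Λ₂ h12 A
    -- The corner over `Λ₁`, included in `Λ₂`, may be compressed by the projection of `Λ₂` without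
    -- changing φ. The compression `adIso` does commute with inclusions and undoes the corner.
    rw [hψ, hψ, ← localIncl_incl h12, ← h.map_corner_adIso hφ Λ₂ (incl h12 _), incl_adIso, adIso_corner]
  have h2 : ∀ Λ A, 0 ≤ ψ Λ (star A * A) := fun Λ A => by
    rw [hψ, corner_mul, corner_star, map_mul, map_star]
    exact hφ.1 _
  have h3 : ∀ Λ, ψ Λ 1 = 1 := h
  refine ⟨stateOfLocal ψ h1 h2 h3, stateOfLocal_mem_stateSpace ψ h1 h2 h3,
    weakDual_ext_local fun Λ a => ?_⟩
  rw [pullback_localIncl, stateOfLocal_localIncl, hψ, h.map_corner_adIso hφ]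

theorem pullback_add_smul (f : H →ₗᵢ[ℂ] K) (s t : ℝ) (ω ω' : WeakDual ℂ (QuasiLocal Γ H)) :
    pullback f (s • ω + t • ω') = s • pullback f ω + t • pullback f ω' := rfl

/-- If a projection has expectation one in a proper convex combination of two states, it has
expectation one in the first of them. -/
theorem state_eq_one_of_openSegment {A : Type u} [CStarAlgebra A] {φ φ₁ φ₂ : WeakDual ℂ A}
    (h₁ : φ₁ ∈ stateSpace A) (h₂ : φ₂ ∈ stateSpace A) (h : φ ∈ openSegment ℝ φ₁ φ₂)
    {e : A} (hs : star e = e) (he : e * e = e) (h1 : φ e = 1) : φ₁ e = 1 := by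
  obtain ⟨s, t, hs0, ht0, hst, rfl⟩ := h
  have h1' : (s : ℂ) * φ₁ e + t * φ₂ e = 1 := h1
  -- Since e and `1 - e` are both projections, a state takes a real value at most 1 on e; a proper
  -- average of such values is 1 only if each of them is.
  have key : ∀ {ψ : WeakDual ℂ A}, ψ ∈ stateSpace A → ∃ r : ℝ, r ≤ 1 ∧ ψ e = r := by
    intro ψ hψ
    have h0 := hψ.1 e
    rw [hs, he] at h0
    obtain ⟨r, hr⟩ : ∃ r : ℝ, ψ e = r := ⟨(ψ e).re, Complex.eq_re_of_ofReal_le (r := 0) (by simpa using h0)⟩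
    refine ⟨r, ?_, hr⟩
    have h2 := hψ.1 (1 - e)
    have : star (1 - e) * (1 - e) = 1 - e := by
      rw [star_sub, star_one, hs, mul_sub, sub_mul, sub_mul, he]
      simp
    rw [this, map_sub, hψ.2, hr] at h2
    have h3 : (0 : ℝ) ≤ 1 - r := by exact_mod_cast h2
    linarith
  obtain ⟨r₁, hr₁, e₁⟩ := key h₁
  obtain ⟨r₂, hr₂, e₂⟩ := key h₂
  rw [e₁, e₂] at h1'
  have h3 : s * r₁ + t * r₂ = 1 := by exact_mod_cast h1'
  rw [e₁]
  have : r₁ = 1 := by nlinarith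
  rw [this, Complex.ofReal_one]

theorem IsSupportedOn.of_openSegment {f : H →ₗᵢ[ℂ] K} {φ φ₁ φ₂ : WeakDual ℂ (QuasiLocal Γ K)}
    (h₁ : φ₁ ∈ stateSpace (QuasiLocal Γ K)) (h₂ : φ₂ ∈ stateSpace (QuasiLocal Γ K))
    (h : φ ∈ openSegment ℝ φ₁ φ₂) (hφ : IsSupportedOn f φ) : IsSupportedOn f φ₁ := fun Λ =>
  state_eq_one_of_openSegment h₁ h₂ h (by rw [← map_star, ← corner_star, star_one])
    (by rw [← map_mul, ← corner_mul, one_mul]) (hφ Λ)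

/-- The supported states form a face of the state space: the components of a decomposition of
`pullback f ω` are themselves pullbacks. Since the pullback is affine and injective, the
decomposition descends to one of ω. -/
theorem pullback_mem_extremePoints (f : H →ₗᵢ[ℂ] K) {ω : WeakDual ℂ (QuasiLocal Γ H)}
    (hω : ω ∈ (stateSpace (QuasiLocal Γ H)).extremePoints ℝ) :
    pullback f ω ∈ (stateSpace (QuasiLocal Γ K)).extremePoints ℝ := by
  refine ⟨pullback_mem_stateSpace f hω.1, fun φ₁ h₁ φ₂ h₂ h => ?_⟩
  have hs := isSupportedOn_pullback f hω.1
  obtain ⟨ψ₁, hψ₁, rfl⟩ := (IsSupportedOn.of_openSegment h₁ h₂ h hs).exists_pullback_eq h₁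
  obtain ⟨ψ₂, hψ₂, rfl⟩ := (IsSupportedOn.of_openSegment h₂ h₁
    (by rwa [openSegment_symm]) hs).exists_pullback_eq h₂
  obtain ⟨s, t, hs0, ht0, hst, he⟩ := h
  rw [← pullback_add_smul] at he
  rw [hω.2 hψ₁ hψ₂ ⟨s, t, hs0, ht0, hst, pullback_injective f he⟩]

theorem mem_extremePoints_of_pullback (f : H →ₗᵢ[ℂ] K) {ψ : WeakDual ℂ (QuasiLocal Γ H)}
    (hψ : ψ ∈ stateSpace (QuasiLocal Γ H))
    (h : pullback f ψ ∈ (stateSpace (QuasiLocal Γ K)).extremePoints ℝ) :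
    ψ ∈ (stateSpace (QuasiLocal Γ H)).extremePoints ℝ := by
  refine ⟨hψ, fun ψ₁ h₁ ψ₂ h₂ hseg => pullback_injective f ?_⟩
  obtain ⟨s, t, hs0, ht0, hst, rfl⟩ := hseg
  exact h.2 (pullback_mem_stateSpace f h₁) (pullback_mem_stateSpace f h₂)
    ⟨s, t, hs0, ht0, hst, rfl⟩

/-- The map `𝒫_Γ(f) : 𝒫_Γ(H) → 𝒫_Γ(K)`, `ω ↦ ω ∘ 𝔄_Γ(f)`. -/
def pureMap (f : H →ₗᵢ[ℂ] K) (ω : PureStateSpace (QuasiLocal Γ H)) :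
    PureStateSpace (QuasiLocal Γ K) :=
  ⟨pullback f ω.1, pullback_mem_extremePoints f ω.2⟩

theorem continuous_pureMap (f : H →ₗᵢ[ℂ] K) : Continuous (pureMap (Γ := Γ) f) :=
  Continuous.subtype_mk (WeakDual.continuous_of_continuous_eval fun A =>
    (continuous_eval_weakDual (quasiLocalMap Γ f A)).comp continuous_subtype_val) _

/-- This describes the image by equations that are weak* closed, whence the closedness of the
embedding. -/
theorem range_pureMap (f : H →ₗᵢ[ℂ] K) :
    Set.range (pureMap (Γ := Γ) f) = {φ | IsSupportedOn f φ.1} := by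
  ext φ
  constructor
  · rintro ⟨ω, rfl⟩
    exact isSupportedOn_pullback f ω.2.1
  · intro h
    obtain ⟨ψ, hψ, he⟩ := h.exists_pullback_eq φ.2.1
    exact ⟨⟨ψ, mem_extremePoints_of_pullback f hψ (he ▸ φ.2)⟩, Subtype.ext he⟩

theorem isClosedEmbedding_pureMap (f : H →ₗᵢ[ℂ] K) :
    IsClosedEmbedding (pureMap (Γ := Γ) f) := by
  refine ⟨⟨⟨le_antisymm (continuous_iff_le_induced.1 (continuous_pureMap f)) ?_⟩,
    fun ω ω' h => Subtype.ext (pullback_injective f (congrArg Subtype.val h))⟩, ?_⟩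
  · rw [← continuous_id_iff_le]
    -- With t the topology pulled back from the target, it remains to see that t is at least as fine
    -- as the weak* topology. Local evaluations are t-continuous, since `ω(A)` is the value of the
    -- image state at the corner of A.
    let t : TopologicalSpace (PureStateSpace (QuasiLocal Γ H)) :=
      .induced (pureMap f) inferInstance
    have ht : Continuous[t, _] (pureMap (Γ := Γ) f) := continuous_induced_dom
    refine continuous_induced_rng (t₁ := t) |>.2 ?_
    refine @continuous_of_local_eval Γ H _ _ _ _ _ t _ (fun ω => ω.2.1) fun Λ A => ?_
    have : (fun ω : PureStateSpace (QuasiLocal Γ H) => ω.1 (localIncl Λ A)) =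
        fun ω => (pureMap f ω).1 (localIncl Λ (corner f Λ A)) :=
      funext fun ω => apply_localIncl_eq_pullback f ω.1 Λ A
    change Continuous[t, _] fun ω : PureStateSpace (QuasiLocal Γ H) => ω.1 (localIncl Λ A)
    rw [this]
    exact @Continuous.comp _ _ _ t _ _ _ _
      ((continuous_eval_weakDual _).comp continuous_subtype_val) ht
  · rw [range_pureMap]
    simp only [IsSupportedOn, Set.ofPred_forall]
    exact isClosed_iInter fun Λ => isClosed_eq
      ((continuous_eval_weakDual _).comp continuous_subtype_val) continuous_const

theorem pullback_localIncl_tensorOp (f : H →ₗᵢ[ℂ] K) (ω : WeakDual ℂ (QuasiLocal Γ H))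
    (Λ : Finset Γ) (a : Λ → (K →L[ℂ] K)) :
    pullback f ω (localIncl Λ (tensorOp a)) = ω (localIncl Λ (tensorOp fun v =>
      f.toContinuousLinearMap.adjoint ∘L a v ∘L f.toContinuousLinearMap)) := by
  rw [pullback_localIncl, adIso_tensorOp]

theorem pullback_id (ω : WeakDual ℂ (QuasiLocal Γ H)) : pullback LinearIsometry.id ω = ω :=
  weakDual_ext_local fun Λ a => by
    rw [pullback_localIncl_tensorOp]
    congr 3
    funext v
    ext x
    refine ext_inner_right ℂ fun y => ?_
    simp [ContinuousLinearMap.adjoint_inner_left]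

theorem pullback_comp (g : K →ₗᵢ[ℂ] L) (f : H →ₗᵢ[ℂ] K) (ω : WeakDual ℂ (QuasiLocal Γ H)) :
    pullback (g.comp f) ω = pullback g (pullback f ω) :=
  weakDual_ext_local fun Λ a => by
    rw [pullback_localIncl_tensorOp, pullback_localIncl_tensorOp, pullback_localIncl_tensorOp]
    congr 3
    funext v
    ext x
    refine ext_inner_right ℂ fun y => ?_
    simp [ContinuousLinearMap.adjoint_inner_left]

end Pullback

/-! ### First countability of pure state spaces -/

section Metrizable

variable {A : Type u} [CStarAlgebra A]

/-- Evaluation on a dense sequence induces the topology from `ℕ → ℂ`: by contractivity of states,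
convergence on a dense set of observables is weak* convergence. -/
instance [SeparableSpace A] : FirstCountableTopology (PureStateSpace A) := by
  let D : Set A := Set.range (denseSeq A)
  let F : PureStateSpace A → ℕ → ℂ := fun ω n => ω.1 (denseSeq A n)
  have hF : Continuous F :=
    continuous_pi fun n => (continuous_eval_weakDual _).comp continuous_subtype_val
  have : IsInducing F := by
    refine ⟨le_antisymm (continuous_iff_le_induced.1 hF) ?_⟩
    rw [← continuous_id_iff_le]
    let t : TopologicalSpace (PureStateSpace A) := .induced F inferInstance
    have ht : Continuous[t, _] F := continuous_induced_dom
    refine continuous_induced_rng (t₁ := t) |>.2 ?_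
    refine @continuous_of_dense_eval A _ _ t D (denseRange_denseSeq A) _ (fun ω => ω.2.1) ?_
    rintro _ ⟨n, rfl⟩
    exact @Continuous.comp _ _ _ t _ _ _ _ (continuous_apply n) ht
  exact this.firstCountableTopology

/-- First countability makes the space a k-space, and the weak* topology is Hausdorff. Compactness
cannot be used here, as the pure states need not be closed among the states. -/
instance [SeparableSpace A] : CGWHSpace (PureStateSpace A) where

end Metrizable

/-! ### Tensor products of states -/

section Schur

variable {A : Type*} [CStarAlgebra A] {B : Type*} [CStarAlgebra B]

/-- The quadratic form of the Gram matrix at x is φ of `s^* s` with `s = ∑ x_i a_i`. -/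
theorem posSemidef_gram {φ : A →ₗ[ℂ] ℂ} (hφ : ∀ a, 0 ≤ φ (star a * a)) {n : ℕ} (a : Fin n → A) :
    (Matrix.of fun i j => φ (star (a i) * a j)).PosSemidef := by
  refine Matrix.PosSemidef.of_dotProduct_mulVec_nonneg ?_ fun x => ?_
  · ext i j
    rw [Matrix.conjTranspose_apply, Matrix.of_apply, Matrix.of_apply, ← map_star_of_positive hφ,
      star_mul, star_star]
  · have h := hφ (∑ i, x i • a i)
    rw [star_sum, Finset.sum_mul, map_sum] at h
    refine h.trans_eq (Finset.sum_congr rfl fun i _ => ?_)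
    rw [Finset.mul_sum, map_sum, Matrix.mulVec, dotProduct, Finset.mul_sum]
    refine Finset.sum_congr rfl fun j _ => ?_
    rw [star_smul, smul_mul_smul_comm, map_smul, Matrix.of_apply, smul_eq_mul, Pi.star_apply]
    ring

/-- Schur product theorem: the entrywise product of two positive semidefinite Gram matrices is
positive semidefinite, evaluated here at the all-ones vector. -/
theorem sum_map_mul_map_nonneg {φ : A →ₗ[ℂ] ℂ} (hφ : ∀ a, 0 ≤ φ (star a * a))
    {ψ : B →ₗ[ℂ] ℂ} (hψ : ∀ b, 0 ≤ ψ (star b * b)) {n : ℕ} (a : Fin n → A) (b : Fin n → B) :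
    0 ≤ ∑ i, ∑ j, φ (star (a i) * a j) * ψ (star (b i) * b j) := by
  have h := ((posSemidef_gram hφ a).hadamard (posSemidef_gram hψ b)).dotProduct_mulVec_nonneg
    (fun _ => 1)
  simpa [dotProduct, Matrix.mulVec] using h

end Schur

/-! ### Product functionals on local algebras -/

section LocalTensor

variable {Γ : Type u} {H K : Type v} [NormedAddCommGroup H] [InnerProductSpace ℂ H]
  [FiniteDimensional ℂ H] [NormedAddCommGroup K] [InnerProductSpace ℂ K] [FiniteDimensional ℂ K]

/-- Site by site, `a ⊗ 1` commutes with `1 ⊗ b`; bilinearity extends this from elementary tensors.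
-/
theorem commute_localSiteMap (Λ : Finset Γ) (A : LocAlg Λ H) (B : LocAlg Λ K) :
    Commute (localSiteMap (tensorLeftHom H K) Λ A) (localSiteMap (tensorRightHom H K) Λ B) := by
  have : (LinearMap.mul ℂ (LocAlg Λ (H ⊗[ℂ] K))).compl₁₂
        (localSiteMap (tensorLeftHom H K) Λ).toAlgHom.toLinearMap
        (localSiteMap (tensorRightHom H K) Λ).toAlgHom.toLinearMap =
      (LinearMap.mul ℂ (LocAlg Λ (H ⊗[ℂ] K))).flip.compl₁₂
        (localSiteMap (tensorLeftHom H K) Λ).toAlgHom.toLinearMap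
        (localSiteMap (tensorRightHom H K) Λ).toAlgHom.toLinearMap := by
    refine op_linearMap_ext fun a => op_linearMap_ext fun b => ?_
    change localSiteMap (tensorLeftHom H K) Λ (tensorOp a) *
        localSiteMap (tensorRightHom H K) Λ (tensorOp b) =
      localSiteMap (tensorRightHom H K) Λ (tensorOp b) *
        localSiteMap (tensorLeftHom H K) Λ (tensorOp a)
    rw [localSiteMap_tensorOp, localSiteMap_tensorOp, tensorOp_mul, tensorOp_mul]
    congr 1
    funext v
    exact ContinuousLinearMap.coe_injective (TensorProduct.ext' fun _ _ => rfl)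
  exact DFunLike.congr_fun (DFunLike.congr_fun this A) B

/-- The linear map `𝔄_Λ(H) ⊗ 𝔄_Λ(K) → 𝔄_Λ(H ⊗ K)`. -/
def localTensor (Λ : Finset Γ) :
    LocAlg Λ H ⊗[ℂ] LocAlg Λ K →ₗ[ℂ] LocAlg Λ (H ⊗[ℂ] K) :=
  TensorProduct.lift ((LinearMap.mul ℂ (LocAlg Λ (H ⊗[ℂ] K))).compl₁₂
    (localSiteMap (tensorLeftHom H K) Λ).toAlgHom.toLinearMap
    (localSiteMap (tensorRightHom H K) Λ).toAlgHom.toLinearMap)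

theorem localTensor_tmul (Λ : Finset Γ) (A : LocAlg Λ H) (B : LocAlg Λ K) :
    localTensor Λ (A ⊗ₜ B) =
      localSiteMap (tensorLeftHom H K) Λ A * localSiteMap (tensorRightHom H K) Λ B := rfl

theorem localTensor_tensorOp (Λ : Finset Γ) (a : Λ → (H →L[ℂ] H)) (b : Λ → (K →L[ℂ] K)) :
    localTensor Λ (tensorOp a ⊗ₜ tensorOp b) =
      tensorOp fun v => TensorProduct.mapL (a v) (b v) := by
  rw [localTensor_tmul, localSiteMap_tensorOp, localSiteMap_tensorOp, tensorOp_mul]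
  rfl

theorem localTensor_star_mul (Λ : Finset Γ) (A A' : LocAlg Λ H) (B B' : LocAlg Λ K) :
    star (localTensor Λ (A ⊗ₜ B)) * localTensor Λ (A' ⊗ₜ B') =
      localTensor Λ ((star A * A') ⊗ₜ (star B * B')) := by
  simp only [localTensor_tmul, map_mul, star_mul, map_star]
  rw [← map_star (localSiteMap (tensorLeftHom H K) Λ),
    ← map_star (localSiteMap (tensorRightHom H K) Λ)]
  simp only [mul_assoc]
  rw [← mul_assoc (localSiteMap (tensorRightHom H K) Λ (star B)),
    ← (commute_localSiteMap Λ (star A) (star B)).eq, mul_assoc,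
    ← mul_assoc (localSiteMap (tensorRightHom H K) Λ (star B)),
    ← (commute_localSiteMap Λ A' (star B)).eq, mul_assoc]

/-- Every operator on `H ⊗ K` is a finite sum of operators `a ⊗ b`. -/
theorem exists_sum_mapL (c : H ⊗[ℂ] K →L[ℂ] H ⊗[ℂ] K) :
    ∃ (n : ℕ) (a : Fin n → (H →L[ℂ] H)) (b : Fin n → (K →L[ℂ] K)),
      c = ∑ j, TensorProduct.mapL (a j) (b j) := by
  obtain ⟨n, a, b, h⟩ :=
    TensorProduct.exists_sum_tmul_eq ((homTensorHomEquiv ℂ H K H K).symm c.toLinearMap)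
  refine ⟨n, fun j => LinearMap.toContinuousLinearMap (a j),
    fun j => LinearMap.toContinuousLinearMap (b j), ContinuousLinearMap.coe_injective ?_⟩
  rw [LinearEquiv.symm_apply_eq, map_sum] at h
  refine h.trans ?_
  ext x y
  simp [homTensorHomEquiv_apply]

theorem localTensor_surjective (Λ : Finset Γ) :
    Function.Surjective (localTensor (H := H) (K := K) Λ) := by
  classical
  rw [← LinearMap.range_eq_top, eq_top_iff]
  rintro T -
  obtain ⟨t, rfl⟩ := opMap_surjective T
  induction t using PiTensorProduct.induction_on with
  | add x y hx hy =>
    rw [map_add]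
    exact add_mem hx hy
  | smul_tprod r c =>
    rw [map_smul, opMap_tprod]
    refine Submodule.smul_mem _ _ ?_
    choose n a b h using fun v => exists_sum_mapL (c v)
    -- Each one-site operator is a finite sum of `a ⊗ b`; multilinearity expands the product over
    -- sites into a sum over choices r of one summand per site.
    rw [funext h, ← tensorOpMultilinear_apply, MultilinearMap.map_sum]
    refine Submodule.sum_mem _ fun r _ => ?_
    exact ⟨_, localTensor_tensorOp Λ (fun v => a v (r v)) (fun v => b v (r v))⟩

theorem finrank_locAlg (Λ : Finset Γ) (H : Type v) [NormedAddCommGroup H] [InnerProductSpace ℂ H]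
    [FiniteDimensional ℂ H] : Module.finrank ℂ (LocAlg Λ H) =
      (Module.finrank ℂ H ^ Λ.card) * (Module.finrank ℂ H ^ Λ.card) := by
  classical
  rw [← (LinearMap.toContinuousLinearMap (𝕜 := ℂ) (E := TPow Λ H)
      (F' := TPow Λ H)).finrank_eq, Module.finrank_linearMap,
    Module.finrank_eq_card_basis (TPow.basis Λ H)]
  simp

/-- A surjection between spaces of equal finite dimension. Injectivity is what makes the product
functional well defined. -/
theorem localTensor_bijective (Λ : Finset Γ) :
    Function.Bijective (localTensor (H := H) (K := K) Λ) := by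
  refine ⟨(LinearMap.injective_iff_surjective_of_finrank_eq_finrank ?_).2
    (localTensor_surjective Λ), localTensor_surjective Λ⟩
  rw [Module.finrank_tensorProduct, finrank_locAlg, finrank_locAlg, finrank_locAlg,
    Module.finrank_tensorProduct]
  ring

/-- The isomorphism `𝔄_Λ(H) ⊗ 𝔄_Λ(K) ≃ 𝔄_Λ(H ⊗ K)`. -/
def localTensorEquiv (Λ : Finset Γ) :
    LocAlg Λ H ⊗[ℂ] LocAlg Λ K ≃ₗ[ℂ] LocAlg Λ (H ⊗[ℂ] K) :=
  LinearEquiv.ofBijective (localTensor Λ) (localTensor_bijective Λ)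

theorem tensor_linearMap_ext {Λ : Finset Γ} {E : Type*} [AddCommMonoid E] [Module ℂ E]
    {f g : LocAlg Λ (H ⊗[ℂ] K) →ₗ[ℂ] E}
    (h : ∀ (a : Λ → (H →L[ℂ] H)) (b : Λ → (K →L[ℂ] K)),
      f (tensorOp fun v => TensorProduct.mapL (a v) (b v)) =
        g (tensorOp fun v => TensorProduct.mapL (a v) (b v))) : f = g := by
  have : TensorProduct.curry (f ∘ₗ localTensor Λ) = TensorProduct.curry (g ∘ₗ localTensor Λ) :=
    op_linearMap_ext fun a => op_linearMap_ext fun b => by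
      simpa [localTensor_tensorOp] using h a b
  have h2 := TensorProduct.curry_injective this
  ext1 T
  obtain ⟨t, rfl⟩ := localTensor_surjective Λ T
  exact DFunLike.congr_fun h2 t

/-- The product functional on `𝔄_Λ(H ⊗ K)`. -/
def productFunctional {Λ : Finset Γ} (φ : LocAlg Λ H →ₗ[ℂ] ℂ) (ψ : LocAlg Λ K →ₗ[ℂ] ℂ) :
    LocAlg Λ (H ⊗[ℂ] K) →ₗ[ℂ] ℂ :=
  (LinearMap.mul' ℂ ℂ ∘ₗ TensorProduct.map φ ψ) ∘ₗ (localTensorEquiv Λ).symm.toLinearMap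

theorem productFunctional_localTensor {Λ : Finset Γ} (φ : LocAlg Λ H →ₗ[ℂ] ℂ)
    (ψ : LocAlg Λ K →ₗ[ℂ] ℂ) (A : LocAlg Λ H) (B : LocAlg Λ K) :
    productFunctional φ ψ (localTensor Λ (A ⊗ₜ B)) = φ A * ψ B := by
  change LinearMap.mul' ℂ ℂ (TensorProduct.map φ ψ
    ((localTensorEquiv Λ).symm (localTensorEquiv Λ (A ⊗ₜ B)))) = _
  rw [LinearEquiv.symm_apply_apply]
  rfl

/-- For T the image of `∑ a_i ⊗ b_i`, the value on `T^* T` is `∑ φ(a_i^* a_j) ψ(b_i^* b_j)`, up to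
the naming of indices, so the Schur product theorem applies. -/
theorem productFunctional_nonneg {Λ : Finset Γ} {φ : LocAlg Λ H →ₗ[ℂ] ℂ}
    {ψ : LocAlg Λ K →ₗ[ℂ] ℂ} (hφ : ∀ A, 0 ≤ φ (star A * A)) (hψ : ∀ B, 0 ≤ ψ (star B * B))
    (T : LocAlg Λ (H ⊗[ℂ] K)) : 0 ≤ productFunctional φ ψ (star T * T) := by
  obtain ⟨t, rfl⟩ := localTensor_surjective Λ T
  obtain ⟨n, a, b, rfl⟩ := TensorProduct.exists_sum_tmul_eq t
  simp only [map_sum, star_sum, Finset.sum_mul, Finset.mul_sum, localTensor_star_mul,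
    productFunctional_localTensor]
  rw [Finset.sum_comm]
  exact sum_map_mul_map_nonneg hφ hψ a b

theorem productFunctional_one {Λ : Finset Γ} {φ : LocAlg Λ H →ₗ[ℂ] ℂ}
    {ψ : LocAlg Λ K →ₗ[ℂ] ℂ} (hφ : φ 1 = 1) (hψ : ψ 1 = 1) : productFunctional φ ψ 1 = 1 := by
  have : (1 : LocAlg Λ (H ⊗[ℂ] K)) = localTensor Λ (1 ⊗ₜ 1) := by
    rw [localTensor_tmul, map_one, map_one, one_mul]
  rw [this, productFunctional_localTensor, hφ, hψ, one_mul]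

theorem extendOne_mapL {Λ₁ Λ₂ : Finset Γ} (a : Λ₁ → (H →L[ℂ] H)) (b : Λ₁ → (K →L[ℂ] K)) :
    extendOne Λ₁ Λ₂ (fun v => TensorProduct.mapL (a v) (b v)) =
      fun v => TensorProduct.mapL (extendOne Λ₁ Λ₂ a v) (extendOne Λ₁ Λ₂ b v) := by
  funext v
  by_cases hv : (v : Γ) ∈ Λ₁
  · simp [extendOne, hv]
  · simp only [extendOne, hv, dite_false]
    exact TensorProduct.mapL_id_id.symm

end LocalTensor

/-! ### Tensor products of states and their purity -/

section TensorState

variable {Γ : Type u} {H K : Type v} [NormedAddCommGroup H] [InnerProductSpace ℂ H]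
  [FiniteDimensional ℂ H] [Nontrivial H] [NormedAddCommGroup K] [InnerProductSpace ℂ K]
  [FiniteDimensional ℂ K] [Nontrivial K]

theorem siteMap_mul (θ : (H →L[ℂ] H) →⋆ₐ[ℂ] (K →L[ℂ] K)) (x y : QuasiLocal Γ H) :
    siteMap Γ θ (x * y) = siteMap Γ θ x * siteMap Γ θ y := by
  have key : ∀ (Λ : Finset Γ) (A B : LocAlg Λ H),
      siteMap Γ θ (localIncl Λ A * localIncl Λ B) =
        siteMap Γ θ (localIncl Λ A) * siteMap Γ θ (localIncl Λ B) := fun Λ A B => by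
    rw [← map_mul (localIncl Λ), siteMap_localIncl, siteMap_localIncl, siteMap_localIncl,
      map_mul (localSiteMap θ Λ), map_mul (localIncl Λ)]
  exact CStarSystem.Colim.induction₂
    (p := fun x y => siteMap Γ θ (x * y) = siteMap Γ θ x * siteMap Γ θ y)
    (isClosed_eq (by fun_prop) (by fun_prop)) (CStarSystem.Union.induction₂ key) x y

variable (Γ) in
/-- The map `⨂_Γ θ` as a `*`-homomorphism. -/
def siteHom (θ : (H →L[ℂ] H) →⋆ₐ[ℂ] (K →L[ℂ] K)) : QuasiLocal Γ H →⋆ₐ[ℂ] QuasiLocal Γ K :=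
  { AlgHom.ofLinearMap (siteMap Γ θ).toLinearMap
      (by
        change siteMap Γ θ 1 = 1
        rw [← map_one (localIncl (H := H) (∅ : Finset Γ)), siteMap_localIncl, map_one, map_one])
      (siteMap_mul θ) with
    map_star' := by
      change ∀ x, siteMap Γ θ (star x) = star (siteMap Γ θ x)
      refine QuasiLocal.induction (isClosed_eq ((siteMap Γ θ).continuous.comp continuous_star)
        (continuous_star.comp (siteMap Γ θ).continuous)) fun Λ A => ?_
      rw [← map_star, siteMap_localIncl, siteMap_localIncl, map_star, map_star] }

theorem siteHom_apply (θ : (H →L[ℂ] H) →⋆ₐ[ℂ] (K →L[ℂ] K)) (A : QuasiLocal Γ H) :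
    siteHom Γ θ A = siteMap Γ θ A := rfl

theorem tensorObs_localIncl (Λ : Finset Γ) (A : LocAlg Λ H) (B : LocAlg Λ K) :
    tensorObs (localIncl Λ A) (localIncl Λ B) = localIncl Λ (localTensor Λ (A ⊗ₜ B)) := by
  rw [tensorObs, siteMap_localIncl, siteMap_localIncl, ← map_mul, localTensor_tmul]

theorem commute_siteHom (A : QuasiLocal Γ H) (B : QuasiLocal Γ K) :
    Commute (siteHom Γ (tensorLeftHom H K) A) (siteHom Γ (tensorRightHom H K) B) := by
  classical
  have hL := (siteMap Γ (tensorLeftHom H K)).continuous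
  have hR := (siteMap Γ (tensorRightHom H K)).continuous
  change siteMap Γ (tensorLeftHom H K) A * siteMap Γ (tensorRightHom H K) B =
    siteMap Γ (tensorRightHom H K) B * siteMap Γ (tensorLeftHom H K) A
  induction A using QuasiLocal.induction with
  | hp => exact isClosed_eq (by fun_prop) (by fun_prop)
  | h Λ₁ A =>
    induction B using QuasiLocal.induction with
    | hp => exact isClosed_eq (by fun_prop) (by fun_prop)
    | h Λ₂ B =>
      -- Both local observables are moved to the common region `Λ₁ ∪ Λ₂`.
      rw [← localIncl_incl (Finset.subset_union_left : Λ₁ ⊆ Λ₁ ∪ Λ₂) A,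
        ← localIncl_incl (Finset.subset_union_right : Λ₂ ⊆ Λ₁ ∪ Λ₂) B, siteMap_localIncl,
        siteMap_localIncl, ← map_mul, ← map_mul, (commute_localSiteMap _ _ _).eq]

theorem weakDual_ext_tensor {ω ω' : WeakDual ℂ (QuasiLocal Γ (H ⊗[ℂ] K))}
    (h : ∀ (Λ : Finset Γ) (a : Λ → (H →L[ℂ] H)) (b : Λ → (K →L[ℂ] K)),
      ω (localIncl Λ (tensorOp fun v => TensorProduct.mapL (a v) (b v))) =
        ω' (localIncl Λ (tensorOp fun v => TensorProduct.mapL (a v) (b v)))) : ω = ω' :=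
  weakDual_ext_local fun Λ c => by
    have : linearOfWeakDual ω ∘ₗ (localIncl Λ).toAlgHom.toLinearMap =
        linearOfWeakDual ω' ∘ₗ (localIncl Λ).toAlgHom.toLinearMap := tensor_linearMap_ext (h Λ)
    exact DFunLike.congr_fun this (tensorOp c)

/-- The restriction of a functional to a local algebra. -/
def localRestrict (ω : WeakDual ℂ (QuasiLocal Γ H)) (Λ : Finset Γ) : LocAlg Λ H →ₗ[ℂ] ℂ :=
  linearOfWeakDual ω ∘ₗ (localIncl Λ).toAlgHom.toLinearMap

theorem localRestrict_apply (ω : WeakDual ℂ (QuasiLocal Γ H)) (Λ : Finset Γ) (A : LocAlg Λ H) :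
    localRestrict ω Λ A = ω (localIncl Λ A) := rfl

theorem localRestrict_nonneg {ω : WeakDual ℂ (QuasiLocal Γ H)}
    (hω : ω ∈ stateSpace (QuasiLocal Γ H)) (Λ : Finset Γ) (A : LocAlg Λ H) :
    0 ≤ localRestrict ω Λ (star A * A) := by
  rw [localRestrict_apply, map_mul, map_star]
  exact hω.1 _

theorem localRestrict_one {ω : WeakDual ℂ (QuasiLocal Γ H)}
    (hω : ω ∈ stateSpace (QuasiLocal Γ H)) (Λ : Finset Γ) : localRestrict ω Λ 1 = 1 := by
  rw [localRestrict_apply, map_one, hω.2]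

theorem productFunctional_incl (ω₁ : WeakDual ℂ (QuasiLocal Γ H))
    (ω₂ : WeakDual ℂ (QuasiLocal Γ K)) ⦃Λ₁ Λ₂ : Finset Γ⦄ (h : Λ₁ ≤ Λ₂)
    (A : LocAlg Λ₁ (H ⊗[ℂ] K)) :
    productFunctional (localRestrict ω₁ Λ₂) (localRestrict ω₂ Λ₂) (incl h A) =
      productFunctional (localRestrict ω₁ Λ₁) (localRestrict ω₂ Λ₁) A := by
  have : productFunctional (localRestrict ω₁ Λ₂) (localRestrict ω₂ Λ₂) ∘ₗ
      (incl h).toAlgHom.toLinearMap =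
      productFunctional (localRestrict ω₁ Λ₁) (localRestrict ω₂ Λ₁) :=
    tensor_linearMap_ext fun a b => by
      change productFunctional (localRestrict ω₁ Λ₂) (localRestrict ω₂ Λ₂) (incl h _) = _
      rw [incl_tensorOp, extendOne_mapL, ← localTensor_tensorOp, productFunctional_localTensor,
        ← localTensor_tensorOp, productFunctional_localTensor, ← incl_tensorOp h,
        ← incl_tensorOp h, localRestrict_apply, localRestrict_apply, localIncl_incl,
        localIncl_incl]
      rfl
  exact DFunLike.congr_fun this A

/-- The tensor product `ω₁ ⊗ ω₂` of two states. -/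
def tensorState {ω₁ : WeakDual ℂ (QuasiLocal Γ H)} (h₁ : ω₁ ∈ stateSpace (QuasiLocal Γ H))
    {ω₂ : WeakDual ℂ (QuasiLocal Γ K)} (h₂ : ω₂ ∈ stateSpace (QuasiLocal Γ K)) :
    WeakDual ℂ (QuasiLocal Γ (H ⊗[ℂ] K)) :=
  stateOfLocal (fun Λ => productFunctional (localRestrict ω₁ Λ) (localRestrict ω₂ Λ))
    (productFunctional_incl ω₁ ω₂)
    (fun Λ => productFunctional_nonneg (localRestrict_nonneg h₁ Λ) (localRestrict_nonneg h₂ Λ))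
    (fun Λ => productFunctional_one (localRestrict_one h₁ Λ) (localRestrict_one h₂ Λ))

variable {ω₁ : WeakDual ℂ (QuasiLocal Γ H)} (h₁ : ω₁ ∈ stateSpace (QuasiLocal Γ H))
  {ω₂ : WeakDual ℂ (QuasiLocal Γ K)} (h₂ : ω₂ ∈ stateSpace (QuasiLocal Γ K))

theorem tensorState_mem_stateSpace :
    tensorState h₁ h₂ ∈ stateSpace (QuasiLocal Γ (H ⊗[ℂ] K)) :=
  stateOfLocal_mem_stateSpace _ _ _ _

theorem tensorState_localTensor (Λ : Finset Γ) (A : LocAlg Λ H) (B : LocAlg Λ K) :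
    tensorState h₁ h₂ (localIncl Λ (localTensor Λ (A ⊗ₜ B))) =
      ω₁ (localIncl Λ A) * ω₂ (localIncl Λ B) :=
  (stateOfLocal_localIncl _ _ _ _ _ _).trans (productFunctional_localTensor _ _ _ _)

theorem tensorState_tensorOp (Λ : Finset Γ) (a : Λ → (H →L[ℂ] H)) (b : Λ → (K →L[ℂ] K)) :
    tensorState h₁ h₂ (localIncl Λ (tensorOp fun v => TensorProduct.mapL (a v) (b v))) =
      ω₁ (localIncl Λ (tensorOp a)) * ω₂ (localIncl Λ (tensorOp b)) := by
  rw [← localTensor_tensorOp, tensorState_localTensor]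

theorem tensorState_tensorObs (A : QuasiLocal Γ H) (B : QuasiLocal Γ K) :
    tensorState h₁ h₂ (tensorObs A B) = ω₁ A * ω₂ B := by
  classical
  have hL := (siteMap Γ (tensorLeftHom H K)).continuous
  have hR := (siteMap Γ (tensorRightHom H K)).continuous
  have hT := (WeakDual.toStrongDual (tensorState h₁ h₂)).continuous
  have hω₁ := (WeakDual.toStrongDual ω₁).continuous
  have hω₂ := (WeakDual.toStrongDual ω₂).continuous
  induction A using QuasiLocal.induction with
  | hp => exact isClosed_eq (hT.comp (hL.mul continuous_const)) (hω₁.mul continuous_const)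
  | h Λ₁ A =>
    induction B using QuasiLocal.induction with
    | hp => exact isClosed_eq (hT.comp (continuous_const.mul hR)) (continuous_const.mul hω₂)
    | h Λ₂ B =>
      rw [← localIncl_incl (Finset.subset_union_left : Λ₁ ⊆ Λ₁ ∪ Λ₂) A,
        ← localIncl_incl (Finset.subset_union_right : Λ₂ ⊆ Λ₁ ∪ Λ₂) B, tensorObs_localIncl,
        tensorState_localTensor]

/-- If the restriction of a proper convex combination of two states to a subalgebra is pure, it
agrees with the restriction of the first of them. -/
theorem restrict_eq_of_openSegment {A : Type u} [CStarAlgebra A] {B : Type v} [CStarAlgebra B]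
    (π : B →⋆ₐ[ℂ] A) {φ φ₁ φ₂ : WeakDual ℂ A} (h₁ : φ₁ ∈ stateSpace A) (h₂ : φ₂ ∈ stateSpace A)
    (h : φ ∈ openSegment ℝ φ₁ φ₂) {ω : WeakDual ℂ B}
    (hω : ω ∈ (stateSpace B).extremePoints ℝ) (hφ : ∀ b, φ (π b) = ω b) (b : B) :
    φ₁ (π b) = ω b := by
  obtain ⟨s, t, hs, ht, hst, rfl⟩ := h
  have pos : ∀ {ψ : WeakDual ℂ A}, ψ ∈ stateSpace A → ∀ b,
      0 ≤ (linearOfWeakDual ψ ∘ₗ π.toAlgHom.toLinearMap) (star b * b) := by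
    intro ψ hψ b
    change 0 ≤ ψ (π (star b * b))
    rw [map_mul, map_star]
    exact hψ.1 _
  have one : ∀ {ψ : WeakDual ℂ A}, ψ ∈ stateSpace A →
      (linearOfWeakDual ψ ∘ₗ π.toAlgHom.toLinearMap) 1 = 1 := by
    intro ψ hψ
    change ψ (π 1) = 1
    rw [map_one, hψ.2]
  have := hω.2 (positiveWeakDual_mem_stateSpace _ (pos h₁) (one h₁))
    (positiveWeakDual_mem_stateSpace _ (pos h₂) (one h₂))
    ⟨s, t, hs, ht, hst, DFunLike.ext _ _ hφ⟩
  exact DFunLike.congr_fun this b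

/-- A component `φ₁` of a decomposition has marginals `ω₁` and `ω₂`, since these are pure. Rigidity
then gives `φ₁(A ⊗ B) = ω₁(A) φ₁(1 ⊗ B) = ω₁(A) ω₂(B)`, and such values determine `φ₁`. -/
theorem tensorState_mem_extremePoints
    (h₁ : ω₁ ∈ (stateSpace (QuasiLocal Γ H)).extremePoints ℝ)
    (h₂ : ω₂ ∈ (stateSpace (QuasiLocal Γ K)).extremePoints ℝ) :
    tensorState h₁.1 h₂.1 ∈ (stateSpace (QuasiLocal Γ (H ⊗[ℂ] K))).extremePoints ℝ := by
  refine ⟨tensorState_mem_stateSpace _ _, fun φ₁ hφ₁ φ₂ hφ₂ hseg => ?_⟩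
  have hL := restrict_eq_of_openSegment (siteHom Γ (tensorLeftHom H K)) hφ₁ hφ₂ hseg h₁ fun A => by
    -- The second observable is set to 1 to read off the first marginal of the product state.
    have := tensorState_tensorObs h₁.1 h₂.1 A 1
    rwa [h₂.1.2, mul_one, tensorObs, ← siteHom_apply (tensorRightHom H K), map_one, mul_one] at this
  have hR := restrict_eq_of_openSegment (siteHom Γ (tensorRightHom H K)) hφ₁ hφ₂ hseg h₂ fun B => by
    have := tensorState_tensorObs h₁.1 h₂.1 1 B
    rwa [h₁.1.2, one_mul, tensorObs, ← siteHom_apply (tensorLeftHom H K), map_one, one_mul] at this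
  refine weakDual_ext_tensor fun Λ a b => ?_
  rw [tensorState_tensorOp, ← tensorObs_tensorOp]
  exact (map_mul_of_pure _ _ commute_siteHom hφ₁ h₁ hL _ _).trans (congrArg _ (hR _))

/-- The tensor product of pure states. -/
def pureTensor (ω₁ : PureStateSpace (QuasiLocal Γ H)) (ω₂ : PureStateSpace (QuasiLocal Γ K)) :
    PureStateSpace (QuasiLocal Γ (H ⊗[ℂ] K)) :=
  ⟨tensorState ω₁.2.1 ω₂.2.1, tensorState_mem_extremePoints ω₁.2 ω₂.2⟩

/-- A local observable is a finite sum of products `A ⊗ B`, on each of which the evaluation is a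
product of two weak* continuous functions. -/
theorem continuous_pureTensor :
    Continuous fun p : PureStateSpace (QuasiLocal Γ H) × PureStateSpace (QuasiLocal Γ K) =>
      pureTensor p.1 p.2 := by
  refine Continuous.subtype_mk (continuous_of_local_eval
    (fun p => tensorState_mem_stateSpace p.1.2.1 p.2.2.1) fun Λ T => ?_) _
  obtain ⟨t, rfl⟩ := localTensor_surjective Λ T
  induction t with
  | zero => simpa using continuous_const
  | add x y hx hy =>
    simp only [map_add]
    exact hx.add hy
  | tmul A B =>
    simp only [tensorState_localTensor]
    exact ((continuous_eval_weakDual _).comp (continuous_subtype_val.comp continuous_fst)).mul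
      ((continuous_eval_weakDual _).comp (continuous_subtype_val.comp continuous_snd))

end TensorState

/-! ### The unit -/

section Unit

variable {Γ : Type u}

/-- A linear map of ℂ is multiplication by its value at 1. Hence every local algebra over ℂ consists
of scalars, and `𝔄_Γ(ℂ)` has only one state. -/
theorem tensorOp_complex (Λ : Finset Γ) (a : Λ → (ℂ →L[ℂ] ℂ)) :
    tensorOp a = (∏ v, a v 1) • (1 : LocAlg Λ ℂ) := by
  refine clm_ext fun x => ?_
  rw [tensorOp_tprod]
  have : (fun v => a v (x v)) = fun v => a v 1 • x v := funext fun v => by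
    rw [smul_eq_mul, mul_comm, ← smul_eq_mul, ← map_smul, smul_eq_mul, mul_one]
  rw [this]
  exact (PiTensorProduct.tprod ℂ).map_smul_univ _ _

theorem exists_eq_smul_one (Λ : Finset Γ) (A : LocAlg Λ ℂ) : ∃ c : ℂ, A = c • 1 := by
  obtain ⟨t, rfl⟩ := opMap_surjective A
  induction t using PiTensorProduct.induction_on with
  | smul_tprod r a => exact ⟨_, by rw [map_smul, opMap_tprod, tensorOp_complex, smul_smul]⟩
  | add x y hx hy =>
    obtain ⟨c, hc⟩ := hx
    obtain ⟨d, hd⟩ := hy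
    exact ⟨c + d, by
      rw [map_add, hc, hd]
      exact (add_smul c d (1 : LocAlg Λ ℂ)).symm⟩

/-- The vector functional of `⨂_v 1` on `𝔄_Λ(ℂ)`. -/
def unitFunctional (Λ : Finset Γ) : LocAlg Λ ℂ →ₗ[ℂ] ℂ where
  toFun A := inner ℂ (TPow.tprod fun _ : Λ => (1 : ℂ)) (A (TPow.tprod fun _ : Λ => (1 : ℂ)))
  map_add' A B := by rw [add_apply, inner_add_right]
  map_smul' c A := by rw [smul_apply, inner_smul_right]; rfl

theorem unitFunctional_one (Λ : Finset Γ) : unitFunctional Λ 1 = 1 := by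
  change inner ℂ (TPow.tprod fun _ : Λ => (1 : ℂ)) (TPow.tprod fun _ : Λ => (1 : ℂ)) = 1
  rw [TPow.inner_tprod]
  simp

theorem unitFunctional_nonneg (Λ : Finset Γ) (A : LocAlg Λ ℂ) :
    0 ≤ unitFunctional Λ (star A * A) := by
  change 0 ≤ inner ℂ (TPow.tprod fun _ : Λ => (1 : ℂ))
    (A.adjoint (A (TPow.tprod fun _ : Λ => (1 : ℂ))))
  rw [ContinuousLinearMap.adjoint_inner_right, inner_self_eq_norm_sq_to_K]
  have h : 0 ≤ ‖A (TPow.tprod fun _ : Λ => (1 : ℂ))‖ ^ 2 := sq_nonneg _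
  exact (Complex.zero_le_real.2 h).trans_eq (Complex.ofReal_pow _ _)

theorem unitFunctional_incl ⦃Λ₁ Λ₂ : Finset Γ⦄ (h : Λ₁ ≤ Λ₂) (A : LocAlg Λ₁ ℂ) :
    unitFunctional Λ₂ (incl h A) = unitFunctional Λ₁ A := by
  obtain ⟨c, rfl⟩ := exists_eq_smul_one Λ₁ A
  rw [map_smul, map_one, map_smul, map_smul, unitFunctional_one, unitFunctional_one]

theorem eq_of_mem_stateSpace_complex {ω ω' : WeakDual ℂ (QuasiLocal Γ ℂ)}
    (h : ω ∈ stateSpace (QuasiLocal Γ ℂ)) (h' : ω' ∈ stateSpace (QuasiLocal Γ ℂ)) : ω = ω' :=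
  weakDual_ext_local fun Λ a => by
    rw [tensorOp_complex, map_smul, map_one, map_smul, map_smul, h.2, h'.2]

variable (Γ) in
/-- The unique state of `𝔄_Γ(ℂ)`. -/
def unitState : PureStateSpace (QuasiLocal Γ ℂ) :=
  ⟨stateOfLocal unitFunctional unitFunctional_incl unitFunctional_nonneg unitFunctional_one,
    -- Extremality is automatic when there is only one state.
    stateOfLocal_mem_stateSpace _ _ _ _, fun _ h _ _ _ =>
      eq_of_mem_stateSpace_complex h (stateOfLocal_mem_stateSpace _ _ _ _)⟩

end Unit

/-! ### Continuous dependence on the isometry -/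

section Continuity

theorem TPow.continuous_tprod {ι : Type u} [Fintype ι] {H : Type v} [NormedAddCommGroup H]
    [InnerProductSpace ℂ H] [FiniteDimensional ℂ H] :
    Continuous (TPow.tprod : (ι → H) → TPow ι H) := by
  classical
  have : (TPow.tprod : (ι → H) → TPow ι H) = fun x =>
      ∑ p, (∏ i, inner ℂ (stdOrthonormalBasis ℂ H (p i)) (x i)) • TPow.basis ι H p := by
    funext x
    simp_rw [← TPow.basis_repr_tprod]
    exact ((TPow.basis ι H).sum_repr _).symm
  rw [this]
  fun_prop

variable {Γ : Type u} {H K : Type v} [NormedAddCommGroup H] [InnerProductSpace ℂ H]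
  [FiniteDimensional ℂ H] [NormedAddCommGroup K] [InnerProductSpace ℂ K] [FiniteDimensional ℂ K]

/-- In finite dimension it suffices to follow the images of basis tensors, which are elementary
tensors of vectors depending continuously on x. -/
theorem continuous_isoPow {X : Type*} [TopologicalSpace X] {f : X → H →ₗᵢ[ℂ] K}
    (hf : Continuous fun x => (f x).toContinuousLinearMap) (Λ : Finset Γ) :
    Continuous fun x => isoPow (f x) Λ := by
  classical
  refine continuous_clm_apply.2 fun y => ?_
  have : y = ∑ p, (TPow.basis Λ H).repr y p • TPow.basis Λ H p :=
    ((TPow.basis Λ H).sum_repr y).symm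
  rw [this]
  simp only [map_sum, map_smul, TPow.basis_apply, isoPow, tensorOp_tprod]
  have h : ∀ p : Λ → Fin (Module.finrank ℂ H), Continuous fun x =>
      TPow.tprod fun v => (f x).toContinuousLinearMap (stdOrthonormalBasis ℂ H (p v)) := fun p =>
    TPow.continuous_tprod.comp (continuous_pi fun v => hf.clm_apply continuous_const)
  fun_prop

theorem continuous_adIso {X : Type*} [TopologicalSpace X] {f : X → H →ₗᵢ[ℂ] K}
    (hf : Continuous fun x => (f x).toContinuousLinearMap) (Λ : Finset Γ) (A : LocAlg Λ K) :
    Continuous fun x => adIso (f x) Λ A := by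
  have h := continuous_isoPow hf Λ
  exact (ContinuousLinearMap.adjoint.continuous.comp h).clm_comp (continuous_const.clm_comp h)

/-- The evaluation of states on observables is jointly continuous. -/
theorem continuous_state_apply {X : Type*} [TopologicalSpace X] {A : Type u} [CStarAlgebra A]
    {g : X → WeakDual ℂ A} (hg : Continuous g) (hs : ∀ x, g x ∈ stateSpace A) {a : X → A}
    (ha : Continuous a) : Continuous fun x => g x (a x) := by
  refine continuous_iff_continuousAt.2 fun x₀ => ?_
  -- Moving the observable costs at most `‖a x - a x₀‖`, whatever the state; with the observable
  -- fixed at `a x₀`, only weak* continuity of g is needed.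
  have h1 : Filter.Tendsto (fun x => g x (a x - a x₀)) (𝓝 x₀) (𝓝 0) := by
    refine squeeze_zero_norm (fun x => norm_state_le (hs x) _) ?_
    have : Filter.Tendsto (fun x => ‖a x - a x₀‖) (𝓝 x₀) (𝓝 ‖a x₀ - a x₀‖) :=
      ((ha.sub continuous_const).norm).tendsto x₀
    simpa using this
  have h2 : Filter.Tendsto (fun x => g x (a x₀)) (𝓝 x₀) (𝓝 (g x₀ (a x₀))) :=
    ((continuous_eval_weakDual _).comp hg).tendsto x₀
  have h3 := h1.add h2
  rw [zero_add] at h3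
  refine h3.congr fun x => ?_
  rw [← map_add, sub_add_cancel]

/-- On a local observable A the value is `ω(f_Λ^* A f_Λ)`: a weak* continuous state applied to an
observable moving norm-continuously with f. -/
theorem continuous_pureMap_uncurry [Nontrivial H] [Nontrivial K] {X : Type*} [TopologicalSpace X]
    {f : X → H →ₗᵢ[ℂ] K} (hf : Continuous fun x => (f x).toContinuousLinearMap) :
    Continuous fun p : X × PureStateSpace (QuasiLocal Γ H) => pureMap (f p.1) p.2 := by
  have hs : ∀ p : X × PureStateSpace (QuasiLocal Γ H),
      pullback (f p.1) p.2.1 ∈ stateSpace (QuasiLocal Γ K) := fun p =>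
    pullback_mem_stateSpace (f p.1) p.2.2.1
  refine continuous_induced_rng.2 (continuous_of_local_eval hs fun Λ A => ?_)
  simp only [Function.comp_apply, pureMap, pullback_localIncl]
  refine continuous_state_apply (continuous_subtype_val.comp continuous_snd) (fun p => p.2.2.1) ?_
  have hi : Continuous (localIncl (H := H) Λ) :=
    AddMonoidHomClass.continuous_of_bound (localIncl (H := H) Λ) 1 fun A => by
      rw [norm_localIncl, one_mul]
  exact hi.comp ((continuous_adIso hf Λ A).comp continuous_fst)

end Continuity

/-! ### Coherence of the tensor product of states -/

section Coherence

variable {Γ : Type u} {H K L : Type v} [NormedAddCommGroup H] [InnerProductSpace ℂ H]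
  [FiniteDimensional ℂ H] [NormedAddCommGroup K] [InnerProductSpace ℂ K]
  [FiniteDimensional ℂ K] [NormedAddCommGroup L] [InnerProductSpace ℂ L]
  [FiniteDimensional ℂ L]

/-- From `T f = f S` follows `f^* T f = f^* f S = S`. In this form the coherence isomorphisms can be
treated without computing their adjoints. -/
theorem adjoint_comp_comp_eq (f : H →ₗᵢ[ℂ] K) {T : K →L[ℂ] K} {S : H →L[ℂ] H}
    (h : ∀ x, T (f x) = f (S x)) :
    f.toContinuousLinearMap.adjoint ∘L T ∘L f.toContinuousLinearMap = S := by
  have h2 : T ∘L f.toContinuousLinearMap = f.toContinuousLinearMap ∘L S :=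
    ContinuousLinearMap.ext h
  rw [h2, ← ContinuousLinearMap.comp_assoc, adjoint_comp_self_of_isometry,
    ContinuousLinearMap.id_comp]

variable [Nontrivial H] [Nontrivial K] [Nontrivial L]

theorem pullback_tensorOp_of_intertwine (f : H →ₗᵢ[ℂ] K) (ω : WeakDual ℂ (QuasiLocal Γ H))
    (Λ : Finset Γ) {a : Λ → (K →L[ℂ] K)} {b : Λ → (H →L[ℂ] H)}
    (h : ∀ v x, a v (f x) = f (b v x)) :
    pullback f ω (localIncl Λ (tensorOp a)) = ω (localIncl Λ (tensorOp b)) := by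
  rw [pullback_localIncl_tensorOp]
  congr 3
  funext v
  exact adjoint_comp_comp_eq f (h v)

theorem weakDual_ext_threefold {ω ω' : WeakDual ℂ (QuasiLocal Γ (H ⊗[ℂ] (K ⊗[ℂ] L)))}
    (h : ∀ (Λ : Finset Γ) (a : Λ → (H →L[ℂ] H)) (b : Λ → (K →L[ℂ] K)) (c : Λ → (L →L[ℂ] L)),
      ω (localIncl Λ (tensorOp fun v =>
          TensorProduct.mapL (a v) (TensorProduct.mapL (b v) (c v)))) =
        ω' (localIncl Λ (tensorOp fun v =>
          TensorProduct.mapL (a v) (TensorProduct.mapL (b v) (c v))))) : ω = ω' :=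
  weakDual_ext_tensor fun Λ a t => by
    -- For a fixed first factor both functionals are linear in the operator on the tensor power of
    -- `K ⊗ L`, so elementary `b ⊗ c` suffice there.
    have : (localRestrict ω Λ ∘ₗ localTensor Λ) ∘ₗ TensorProduct.mk ℂ _ _ (tensorOp a) =
        (localRestrict ω' Λ ∘ₗ localTensor Λ) ∘ₗ TensorProduct.mk ℂ _ _ (tensorOp a) :=
      tensor_linearMap_ext fun b c => by
        change localRestrict ω Λ (localTensor Λ (tensorOp a ⊗ₜ tensorOp _)) =
          localRestrict ω' Λ (localTensor Λ (tensorOp a ⊗ₜ tensorOp _))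
        rw [localTensor_tensorOp]
        exact h Λ a b c
    rw [← localTensor_tensorOp]
    exact DFunLike.congr_fun this (tensorOp t)

theorem pureMap_id (ω : PureStateSpace (QuasiLocal Γ H)) : pureMap LinearIsometry.id ω = ω :=
  Subtype.ext (pullback_id ω.1)

theorem pureMap_comp (g : K →ₗᵢ[ℂ] L) (f : H →ₗᵢ[ℂ] K) (ω : PureStateSpace (QuasiLocal Γ H)) :
    pureMap (g.comp f) ω = pureMap g (pureMap f ω) :=
  Subtype.ext (pullback_comp g f ω.1)

theorem pureMap_tensorOp (f : H →ₗᵢ[ℂ] K) (ω : PureStateSpace (QuasiLocal Γ H)) (Λ : Finset Γ)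
    (a : Λ → (K →L[ℂ] K)) :
    (pureMap f ω).1 (localIncl Λ (tensorOp a)) = ω.1 (localIncl Λ (tensorOp fun v =>
      f.toContinuousLinearMap.adjoint ∘L a v ∘L f.toContinuousLinearMap)) :=
  pullback_localIncl_tensorOp f ω.1 Λ a

theorem pureTensor_tensorOp (ω₁ : PureStateSpace (QuasiLocal Γ H))
    (ω₂ : PureStateSpace (QuasiLocal Γ K)) (Λ : Finset Γ) (a : Λ → (H →L[ℂ] H))
    (b : Λ → (K →L[ℂ] K)) :
    (pureTensor ω₁ ω₂).1 (localIncl Λ (tensorOp fun v => TensorProduct.mapL (a v) (b v))) =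
      ω₁.1 (localIncl Λ (tensorOp a)) * ω₂.1 (localIncl Λ (tensorOp b)) :=
  tensorState_tensorOp ω₁.2.1 ω₂.2.1 Λ a b

/-- On one site `(f ⊗ g)^* (a ⊗ b) (f ⊗ g) = f^* a f ⊗ g^* b g`, so both states give the same
product of values. -/
theorem pureTensor_natural {H' K' : Type v} [NormedAddCommGroup H'] [InnerProductSpace ℂ H']
    [FiniteDimensional ℂ H'] [Nontrivial H'] [NormedAddCommGroup K'] [InnerProductSpace ℂ K']
    [FiniteDimensional ℂ K'] [Nontrivial K'] (f : H →ₗᵢ[ℂ] H') (g : K →ₗᵢ[ℂ] K')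
    (ω₁ : PureStateSpace (QuasiLocal Γ H)) (ω₂ : PureStateSpace (QuasiLocal Γ K)) :
    pureTensor (pureMap f ω₁) (pureMap g ω₂) =
      pureMap (TensorProduct.mapIsometry f g) (pureTensor ω₁ ω₂) := by
  refine Subtype.ext (weakDual_ext_tensor fun Λ a b => ?_)
  rw [pureTensor_tensorOp, pureMap_tensorOp, pureMap_tensorOp, ← pureTensor_tensorOp,
    pureMap_tensorOp]
  congr 3
  funext v
  rw [TensorProduct.mapL_comp, TensorProduct.mapL_comp, ← TensorProduct.adjoint_mapL,
    TensorProduct.toContinuousLinearMap_mapIsometry]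

/-- The associator intertwines `(a ⊗ b) ⊗ c` with `a ⊗ (b ⊗ c)`, and what remains is associativity
of multiplication of the three values. -/
theorem pureTensor_assoc (ω₁ : PureStateSpace (QuasiLocal Γ H))
    (ω₂ : PureStateSpace (QuasiLocal Γ K)) (ω₃ : PureStateSpace (QuasiLocal Γ L)) :
    pureMap (TensorProduct.assocIsometry ℂ H K L).toLinearIsometry
      (pureTensor (pureTensor ω₁ ω₂) ω₃) = pureTensor ω₁ (pureTensor ω₂ ω₃) := by
  refine Subtype.ext (weakDual_ext_threefold fun Λ a b c => ?_)
  refine (pullback_tensorOp_of_intertwine _ _ Λ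
    (b := fun v => TensorProduct.mapL (TensorProduct.mapL (a v) (b v)) (c v)) ?_).trans ?_
  · intro v x
    have : (TensorProduct.mapL (a v) (TensorProduct.mapL (b v) (c v))).toLinearMap ∘ₗ
        (TensorProduct.assocIsometry ℂ H K L).toLinearIsometry.toLinearMap =
        (TensorProduct.assocIsometry ℂ H K L).toLinearIsometry.toLinearMap ∘ₗ
        (TensorProduct.mapL (TensorProduct.mapL (a v) (b v)) (c v)).toLinearMap :=
      TensorProduct.ext_threefold fun _ _ _ => rfl
    exact DFunLike.congr_fun this x
  · rw [pureTensor_tensorOp, pureTensor_tensorOp, pureTensor_tensorOp, pureTensor_tensorOp,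
      mul_assoc]

end Coherence

/-! ### Compatibility with the monoidal unit -/

section Unitality

variable {Γ : Type u} {H : Type} [NormedAddCommGroup H] [InnerProductSpace ℂ H]
  [FiniteDimensional ℂ H] [Nontrivial H]

theorem unitState_one (Λ : Finset Γ) :
    (unitState Γ).1 (localIncl Λ (tensorOp fun _ => .id ℂ ℂ)) = 1 := by
  rw [tensorOp_id]
  exact (congrArg (unitState Γ).1 (map_one (localIncl Λ))).trans (unitState Γ).2.1.2

/-- The left unitor intertwines `1 ⊗ a` with a, and the unit state contributes the factor 1. -/
theorem pureTensor_leftUnit (ω : PureStateSpace (QuasiLocal Γ H)) :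
    pureMap (TensorProduct.lidIsometry ℂ H).toLinearIsometry (pureTensor (unitState Γ) ω) = ω := by
  refine Subtype.ext (weakDual_ext_local fun Λ a => ?_)
  refine (pullback_tensorOp_of_intertwine _ _ Λ
    (b := fun v => TensorProduct.mapL (.id ℂ ℂ) (a v)) ?_).trans ?_
  · intro v x
    have : (a v).toLinearMap ∘ₗ
        (TensorProduct.lidIsometry ℂ H).toLinearIsometry.toLinearMap =
        (TensorProduct.lidIsometry ℂ H).toLinearIsometry.toLinearMap ∘ₗ
        (TensorProduct.mapL (.id ℂ ℂ) (a v)).toLinearMap :=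
      TensorProduct.ext' fun c x => map_smul (a v) c x
    exact DFunLike.congr_fun this x
  · rw [pureTensor_tensorOp, unitState_one, one_mul]

theorem pureTensor_rightUnit (ω : PureStateSpace (QuasiLocal Γ H)) :
    pureMap (TensorProduct.ridIsometry ℂ H).toLinearIsometry (pureTensor ω (unitState Γ)) = ω := by
  refine Subtype.ext (weakDual_ext_local fun Λ a => ?_)
  refine (pullback_tensorOp_of_intertwine _ _ Λ
    (b := fun v => TensorProduct.mapL (a v) (.id ℂ ℂ)) ?_).trans ?_
  · intro v x
    have : (a v).toLinearMap ∘ₗ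
        (TensorProduct.ridIsometry ℂ H).toLinearIsometry.toLinearMap =
        (TensorProduct.ridIsometry ℂ H).toLinearIsometry.toLinearMap ∘ₗ
        (TensorProduct.mapL (a v) (.id ℂ ℂ)).toLinearMap :=
      TensorProduct.ext' fun x c => map_smul (a v) c x
    exact DFunLike.congr_fun this x
  · rw [pureTensor_tensorOp, unitState_one, mul_one]

end Unitality

/-! ### The functor of pure states -/

/-- Isometries form a closed bounded subset of a finite-dimensional space. Compactness is used to
lift continuity from the compact-open topology to its k-ification. -/
instance (H K : HilbFin) : CompactSpace (H ⟶ K) := by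
  have hi := (HilbFin.isEmbedding_toCLM H K).isInducing
  have hr : Set.range (fun f : H ⟶ K => f.hom.toContinuousLinearMap) =
      {T : H →L[ℂ] K | ∀ x, ‖T x‖ = ‖x‖} := by
    ext T
    constructor
    · rintro ⟨f, rfl⟩ x
      exact f.hom.norm_map x
    · intro hT
      exact ⟨⟨⟨T.toLinearMap, hT⟩⟩, rfl⟩
  have : ProperSpace (H →L[ℂ] K) := FiniteDimensional.proper ℂ _
  refine ⟨hi.isCompact_iff.2 ?_⟩
  rw [Set.image_univ, hr]
  refine Metric.isCompact_of_isClosed_isBounded ?_ ?_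
  · simp only [Set.ofPred_forall]
    exact isClosed_iInter fun x => isClosed_eq (by fun_prop) continuous_const
  · refine (Metric.isBounded_closedBall (x := 0) (r := 1)).subset fun T hT => ?_
    rw [mem_closedBall_zero_iff]
    exact T.opNorm_le_bound zero_le_one fun x => by rw [hT x, one_mul]

variable (Γ : Type u) [Countable Γ]

/-- The functor `𝒫_Γ`. -/
def pureFunctor : FunctorOn (fun H : HilbFin => CGTop.of (PureStates Γ H)) where
  map f := ⟨⟨pureMap f.hom, continuous_pureMap f.hom⟩⟩
  map_id _ := CGTop.Hom.ext (ContinuousMap.ext pureMap_id)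
  map_comp f g := CGTop.Hom.ext (ContinuousMap.ext (pureMap_comp g.hom f.hom))

theorem isTopEnriched_pureFunctor : IsTopEnriched (pureFunctor Γ).toFunctor := by
  intro H K
  refine continuous_induced_rng.2 ?_
  let g : (H ⟶ K) → C(PureStates Γ H, PureStates Γ K) := fun f =>
    ⟨pureMap f.hom, continuous_pureMap f.hom⟩
  have hg : Continuous g := (ContinuousMap.curry ⟨_, continuous_pureMap_uncurry
    (Γ := Γ) (f := fun f : H ⟶ K => f.hom) (HilbFin.isEmbedding_toCLM H K).continuous⟩).continuous
  -- The k-ification tests against compact Hausdorff spaces in universe u, so the space of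
  -- isometries is first lifted to that universe.
  have h := continuous_kTop_of_compact (hg.comp (continuous_uliftDown.{0, u}))
  have h2 := @Continuous.comp _ _ _ _ _ (kTop _) ULift.up (g ∘ ULift.down) h continuous_uliftUp
  exact h2

/-- The lax monoidal structure of `𝒫_Γ`. -/
@[reducible] def laxMonoidalPureFunctor : (pureFunctor Γ).toFunctor.LaxMonoidal where
  ε := ⟨ContinuousMap.const _ (unitState Γ)⟩
  μ H K := ⟨@ContinuousMap.mk (PureStates Γ H × PureStates Γ K) (PureStates Γ (H ⊗ K))
    (kTop _) _ (fun p => pureTensor p.1 p.2)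
    (continuous_from_compactlyGenerated.{u} _ fun _ g => continuous_pureTensor.comp g.continuous)⟩
  -- The untouched factor is rewritten as the image under the identity isometry, so that naturality
  -- in two variables applies.
  μ_natural_left f _ := CGTop.Hom.ext (ContinuousMap.ext fun p =>
    (congrArg (pureTensor _) (pureMap_id p.2).symm).trans
      (pureTensor_natural f.hom LinearIsometry.id p.1 p.2))
  μ_natural_right _ f := CGTop.Hom.ext (ContinuousMap.ext fun p =>
    (congrArg (pureTensor · _) (pureMap_id p.1).symm).trans
      (pureTensor_natural LinearIsometry.id f.hom p.1 p.2))
  associativity _ _ _ := CGTop.Hom.ext (ContinuousMap.ext fun p =>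
    pureTensor_assoc p.1.1 p.1.2 p.2)
  left_unitality _ := CGTop.Hom.ext (ContinuousMap.ext fun p => (pureTensor_leftUnit p.2).symm)
  right_unitality _ := CGTop.Hom.ext (ContinuousMap.ext fun p => (pureTensor_rightUnit p.1).symm)

end QST

end

theorem mainTheorem2 (Γ : Type u) [Countable Γ] :
    ∃ (hcg : ∀ H : HilbFin, CGWHSpace (PureStates Γ H))
      (P : FunctorOn (fun H : HilbFin => @CGTop.of (PureStates Γ H) _ (hcg H))),
      (∀ {H K : HilbFin} (f : H ⟶ K) (ω : PureStates Γ H) (A : QuasiLocal Γ K),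
        ((P.toFunctor.map f).hom ω : PureStates Γ K).1 A = ω.1 (quasiLocalMap Γ f.hom A)) ∧
      IsTopEnriched P.toFunctor ∧
      (∀ {H K : HilbFin} (f : H ⟶ K), IsClosedEmbedding (P.toFunctor.map f).hom) ∧
      ∃ L : P.toFunctor.LaxMonoidal,
        ∀ (H₁ H₂ : HilbFin) (ω₁ : PureStates Γ H₁) (ω₂ : PureStates Γ H₂)
          (A₁ : QuasiLocal Γ H₁) (A₂ : QuasiLocal Γ H₂),
          ((L.μ H₁ H₂).hom (ω₁, ω₂) : PureStates Γ (H₁ ⊗ H₂)).1 (tensorObs A₁ A₂) =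
            ω₁.1 A₁ * ω₂.1 A₂ :=
  ⟨fun _ => inferInstance, pureFunctor Γ, fun _ _ _ => rfl, isTopEnriched_pureFunctor Γ,
    fun f => isClosedEmbedding_pureMap f.hom, laxMonoidalPureFunctor Γ,
    fun _ _ ω₁ ω₂ => tensorState_tensorObs ω₁.2.1 ω₂.2.1⟩
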